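/- Let $N\in\{3,4\}$ and $\rho>0$, and let $B(0,\rho)$ denote the open ball in $\mathbb{R}^N$. Let $V\in L^\infty_{loc}(\mathbb{R}^N\setminus B(0,\rho))$ be real-valued with $$V(x)\le \frac{N(4-N)}{4}\,|x|^{-2}\qquad\text{for a.e. } x \text{ with } |x|\ge\rho .$$ Let $u\in H^1(\mathbb{R}^N)$ be a real-valued function such that $u\ge 0$ a.e. in $\mathbb{R}^N\setminus B(0,\rho)$ and $(-\Delta+V)u\ge 0$ weakly outside the ball, i.e. $$\int (\nabla u\cdot\nabla\varphi+Vu\varphi)\,dx\ge 0\qquad\text{for all } \varphi\in C_c^\infty(\mathbb{R}^N\setminus\overline{B(0,\rho)}),\ \varphi\ge 0 .$$ Then, for every $M\ge\rho$, $$\inf\{u(x):|x|=M\}=0,$$ where the values of $u$ on the sphere $|x|=M$ are those of its trace, and the infimum is the essential infimum with respect to surface measure. Here the trace is the $L^2$ function on the sphere that is the $L^2$-limit of the restrictions $\varphi_n|_{\{|x|=M\}}$ of functions $\varphi_n\in C_c^\infty(\mathbb{R}^N)$ converging to $u$ in $H^1(\mathbb{R}^N)$; that it exists is part of the conclusion.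 If, in addition, $u\in C^1(\mathbb{R}^N\setminus\overline{B(0,\rho)})$, then $u(x)=0$ for all $x$ with $|x|>\rho$. -/

import Mathlib

open MeasureTheory Filter Topology
open scoped ContDiff

namespace ExteriorLiouville

noncomputable section

/-- Euclidean space `ℝ^N`. -/
abbrev Eu (N : ℕ) : Type := EuclideanSpace ℝ (Fin N)

/-- `φ ∈ C_c^∞(Ω)`, extended by zero to the whole space. -/
structure IsTestFunction {N : ℕ} (Ω : Set (Eu N)) (φ : Eu N → ℝ) : Prop where
  contDiff : ContDiff ℝ ∞ φ
  hasCompactSupport : HasCompactSupport φ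
  tsupport_subset : tsupport φ ⊆ Ω

/-- `g` is the weak gradient of `u` on the open set `Ω`:
`u, g ∈ L^1_loc(Ω)` and `∫ u ∇φ = - ∫ φ g` for all `φ ∈ C_c^∞(Ω)`. -/
structure HasWeakGradient {N : ℕ} (Ω : Set (Eu N)) (u : Eu N → ℝ) (g : Eu N → Eu N) : Prop where
  locallyIntegrableOn : LocallyIntegrableOn u Ω
  locallyIntegrableOn_grad : LocallyIntegrableOn g Ω
  integral_eq : ∀ φ : Eu N → ℝ, IsTestFunction Ω φ →
    ∫ x, u x • gradient φ x = - ∫ x, φ x • g x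

/-- `u ∈ H^1(ℝ^N)`. -/
def MemH1 {N : ℕ} (u : Eu N → ℝ) : Prop :=
  MemLp u 2 ∧ ∃ g : Eu N → Eu N, MemLp g 2 ∧ HasWeakGradient Set.univ u g

/-- `V ∈ L^∞_loc(S)`: `V` is measurable and essentially bounded on every compact subset of `S`. -/
def MemLinftyLoc {N : ℕ} (S : Set (Eu N)) (V : Eu N → ℝ) : Prop :=
  ∀ K ⊆ S, IsCompact K → MemLp V ⊤ (volume.restrict K)

/-- `(-Δ + V) u ≥ 0` on the open set `Ω`, in the weak sense:
`∫ (∇u · ∇φ + V u φ) ≥ 0` for all nonnegative `φ ∈ C_c^∞(Ω)`. -/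
def IsWeakSupersolution {N : ℕ} (Ω : Set (Eu N)) (V u : Eu N → ℝ) : Prop :=
  ∃ g : Eu N → Eu N, HasWeakGradient Ω u g ∧
    ∀ φ : Eu N → ℝ, IsTestFunction Ω φ → (∀ x, 0 ≤ φ x) →
      0 ≤ ∫ x, (inner ℝ (g x) (gradient φ x) + V x * u x * φ x)

/-- The surface measure of the sphere `|x| = M` (for `M > 0`), as a measure on `ℝ^N`:
the image of the surface measure of the unit sphere under `θ ↦ M θ`, times `M^(N-1)`. -/
def sphereMeasure (N : ℕ) (M : ℝ) : Measure (Eu N) :=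
  ENNReal.ofReal (M ^ (N - 1)) •
    ((volume : Measure (Eu N)).toSphere).map (fun θ : Metric.sphere (0 : Eu N) 1 => M • (θ : Eu N))

/-- `T` is the trace of `u ∈ H^1(ℝ^N)` on the sphere `|x| = M`: there are `φ_n ∈ C_c^∞(ℝ^N)` with
`φ_n → u` in `H^1(ℝ^N)` and `φ_n → T` in `L^2` of the sphere. By the trace theorem, such a `T`
exists and is unique up to null sets of the surface measure. -/
def IsSphereTrace {N : ℕ} (u : Eu N → ℝ) (M : ℝ) (T : Eu N → ℝ) : Prop :=
  MemLp T 2 (sphereMeasure N M) ∧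
  ∃ g : Eu N → Eu N, HasWeakGradient Set.univ u g ∧
  ∃ φ : ℕ → Eu N → ℝ, (∀ n, IsTestFunction Set.univ (φ n)) ∧
    Tendsto (fun n => eLpNorm (fun x => φ n x - u x) 2 volume) atTop (𝓝 0) ∧
    Tendsto (fun n => eLpNorm (fun x => gradient (φ n) x - g x) 2 volume) atTop (𝓝 0) ∧
    Tendsto (fun n => eLpNorm (fun x => φ n x - T x) 2 (sphereMeasure N M)) atTop (𝓝 0)

end

end ExteriorLiouville

/-! The whole statement follows once `u = 0` a.e. outside the ball. Put `s = |x|²` and `q = N/4`.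
Away from the origin, `|x|^(-N/2)` and `|x|^(2-N/2)` both solve `-Δw + c|x|⁻²w = 0` with `c =
N(4-N)/4`, so the substitution `φ = s^(-q) ζ(s)` removes all lower-order terms: `(-Δ + c|x|⁻²)φ = -4
s^(1-q) ζ''(s)`. Since `u ≥ 0` and `V ≤ c|x|⁻²`, testing with such `φ` gives `∫ u |x|^(2-N/2)
ζ''(|x|²) ≤ 0` for every nonnegative bump `ζ` supported in `(ρ²,∞)`
(`integral_mul_deriv_deriv_nonpos`).

In other words, `r^(N/2)` times the spherical mean of `u` is a concave function of `s = r²`. A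
nonnegative concave function on a half-line is nondecreasing, so if it were not zero the mean would
be at least a multiple of `r^(-N/2)` far out, which is just not square-integrable. The proof makes
this quantitative without defining means: a bump `f ≥ 0` is integrated twice and the primitive is
cut off at scale `R` (`exists_cutoff_primitive`), so `f` is a second derivative `ζ''` up to an error
`O(1/R)` on `[R,2R]`. By Hölder the powers of `R` cancel and the error is bounded by the `L²` tail
of `u`. Thus `∫ u |x|^(2-N/2) f(|x|²) ≤ 0` for every such bump (`integral_mul_bump_nonpos`), which
forces `u = 0`.

For the trace, the fundamental theorem of calculus along rays bounds the `L²` norm on a sphere by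
the exterior `L²` norm of the function and the `L²` norm of its gradient
(`eLpNorm_sphereMeasure_sq_le`). With density of `C_c^∞` in `H^1`, this gives existence of the
trace; because only the exterior norm of the function enters, it also shows that the trace of a
function vanishing outside the sphere is zero. -/

namespace ExteriorLiouville

/-! ### Radial test functions in the variable `|x|²`, and integration by parts against them. -/

/-- A function that is locally integrable on `Ω`, multiplied by a continuous function with compact
support in `Ω`, is integrable. -/
theorem integrable_smul_of_locallyIntegrableOn {N : ℕ} {F : Type*} [NormedAddCommGroup F]
    [NormedSpace ℝ F] {Ω : Set (Eu N)} {f : Eu N → F} (hf : LocallyIntegrableOn f Ω)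
    {φ : Eu N → ℝ} (hφ : Continuous φ) (hc : HasCompactSupport φ) (hs : tsupport φ ⊆ Ω) :
    Integrable (fun x => φ x • f x) := by
  have h1 : IntegrableOn f (tsupport φ) := (hf.mono_set hs).integrableOn_isCompact hc
  have h2 := h1.continuousOn_smul hφ.continuousOn hc
  refine (integrableOn_iff_integrable_of_support_subset ?_).1 h2
  intro x hx
  apply subset_tsupport
  intro h0
  exact hx (by simp [h0])

theorem tsupport_comp_norm_sq_mul_subset {N : ℕ} (H : ℝ → ℝ) (P : Eu N → ℝ) :
    tsupport (fun x : Eu N => H (‖x‖ ^ 2) * P x) ⊆ (fun x : Eu N => ‖x‖ ^ 2) ⁻¹' tsupport H := by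
  refine closure_minimal ?_ ((isClosed_tsupport H).preimage (by fun_prop))
  intro x hx
  apply subset_tsupport
  intro h0
  exact hx (by simp [h0])

/-- The factor `P` lets one statement serve for radial test functions (`P = 1`) and for the
components of a radial vector field (`P` a coordinate). Using `|x|²` rather than `|x|` keeps
everything smooth at the origin. -/
theorem isTestFunction_comp_norm_sq_mul {N : ℕ} {ρ : ℝ} {H : ℝ → ℝ}
    (hH : ContDiff ℝ ∞ H) (hc : HasCompactSupport H) (hs : tsupport H ⊆ Set.Ioi (ρ ^ 2))
    {P : Eu N → ℝ} (hP : ContDiff ℝ ∞ P) :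
    IsTestFunction (Metric.closedBall (0 : Eu N) ρ)ᶜ (fun x => H (‖x‖ ^ 2) * P x) where
  contDiff := (hH.comp (contDiff_norm_sq ℝ)).mul hP
  hasCompactSupport := by
    obtain ⟨B, hB⟩ := hc.isBounded.bddAbove
    refine HasCompactSupport.of_support_subset_isCompact
      (isCompact_closedBall (0 : Eu N) (Real.sqrt B)) ?_
    intro x hx
    have := hB (tsupport_comp_norm_sq_mul_subset H P (subset_tsupport _ hx))
    rw [mem_closedBall_zero_iff]
    exact Real.le_sqrt_of_sq_le this
  tsupport_subset := by
    intro x hx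
    have h1 : ρ ^ 2 < ‖x‖ ^ 2 := hs (tsupport_comp_norm_sq_mul_subset H P hx)
    simp only [Set.mem_compl_iff, mem_closedBall_zero_iff, not_le]
    exact lt_of_pow_lt_pow_left₀ 2 (norm_nonneg _) h1

theorem hasGradientAt_comp_norm_sq {N : ℕ} {G : ℝ → ℝ} {x : Eu N} {G' : ℝ}
    (hG : HasDerivAt G G' (‖x‖ ^ 2)) :
    HasGradientAt (fun y : Eu N => G (‖y‖ ^ 2)) ((2 * G') • x) x := by
  rw [hasGradientAt_iff_hasFDerivAt]
  have h := hG.comp_hasFDerivAt x (hasStrictFDerivAt_norm_sq x).hasFDerivAt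
  convert! h using 1
  ext y
  simp
  ring

theorem gradient_apply_eq_fderiv {N : ℕ} (φ : Eu N → ℝ) (x : Eu N) (i : Fin N) :
    gradient φ x i = fderiv ℝ φ x (EuclideanSpace.single i 1) := by
  rw [← inner_gradient_left, EuclideanSpace.inner_single_right]
  simp

theorem gradient_comp_norm_sq_mul_coord {N : ℕ} {H : ℝ → ℝ} (hH : Differentiable ℝ H) (x : Eu N)
    (i : Fin N) :
    gradient (fun y : Eu N => H (‖y‖ ^ 2) * y i) x i
      = H (‖x‖ ^ 2) + 2 * deriv H (‖x‖ ^ 2) * x i ^ 2 := by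
  rw [gradient_apply_eq_fderiv]
  have h1 := (hH (‖x‖ ^ 2)).hasDerivAt.comp_hasFDerivAt x (hasStrictFDerivAt_norm_sq x).hasFDerivAt
  have h2 : HasFDerivAt (fun y : Eu N => y i) (EuclideanSpace.proj i : Eu N →L[ℝ] ℝ) x :=
    (EuclideanSpace.proj i : Eu N →L[ℝ] ℝ).hasFDerivAt
  have h3 : HasFDerivAt (fun y : Eu N => H (‖y‖ ^ 2) * y i) _ x := h1.mul h2
  rw [h3.fderiv]
  simp [EuclideanSpace.inner_single_right]
  ring

/-- Integration by parts of a weak gradient against the radial vector field `H(|x|²) x`. -/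
theorem HasWeakGradient.integral_inner_radial {N : ℕ} {ρ : ℝ} {u : Eu N → ℝ}
    {g : Eu N → Eu N} (hg : HasWeakGradient (Metric.closedBall (0 : Eu N) ρ)ᶜ u g) {H : ℝ → ℝ}
    (hH : ContDiff ℝ ∞ H) (hc : HasCompactSupport H) (hs : tsupport H ⊆ Set.Ioi (ρ ^ 2)) :
    ∫ x, inner ℝ (g x) (H (‖x‖ ^ 2) • x)
      = - ∫ x, u x * (N * H (‖x‖ ^ 2) + 2 * ‖x‖ ^ 2 * deriv H (‖x‖ ^ 2)) := by
  have hcoord : ∀ i : Fin N, ContDiff ℝ ∞ (fun x : Eu N => x i) := fun i =>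
    (EuclideanSpace.proj i : Eu N →L[ℝ] ℝ).contDiff
  have htest := fun i => isTestFunction_comp_norm_sq_mul hH hc hs (hcoord i)
  have hint1 : ∀ i : Fin N, Integrable (fun x => (H (‖x‖ ^ 2) * x i) • g x) := fun i =>
    integrable_smul_of_locallyIntegrableOn hg.locallyIntegrableOn_grad (htest i).contDiff.continuous
      (htest i).hasCompactSupport (htest i).tsupport_subset
  have hfd : ∀ i : Fin N, Continuous (fderiv ℝ (fun x : Eu N => H (‖x‖ ^ 2) * x i)) := fun i =>
    (htest i).contDiff.continuous_fderiv (by simp)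
  have hint2 : ∀ i : Fin N, Integrable
      (fun x => u x • gradient (fun y : Eu N => H (‖y‖ ^ 2) * y i) x) := by
    intro i
    have hgc : Continuous (gradient (fun y : Eu N => H (‖y‖ ^ 2) * y i)) :=
      (InnerProductSpace.toDual ℝ (Eu N)).symm.continuous.comp (hfd i)
    have hsub : Function.support (gradient (fun y : Eu N => H (‖y‖ ^ 2) * y i)) ⊆
        tsupport (fun y : Eu N => H (‖y‖ ^ 2) * y i) := by
      intro x hx
      apply support_fderiv_subset ℝ
      intro h0
      exact hx (by simp [gradient, h0])
    have hK : IsCompact (tsupport (fun y : Eu N => H (‖y‖ ^ 2) * y i)) :=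
      (htest i).hasCompactSupport
    have h1 := (hg.locallyIntegrableOn.mono_set (htest i).tsupport_subset).integrableOn_isCompact hK
    refine (integrableOn_iff_integrable_of_support_subset ?_).1
      (h1.smul_continuousOn hgc.continuousOn hK)
    intro x hx
    apply hsub
    intro h0
    exact hx (by simp [h0])
  -- The weak gradient identity is vector-valued. Testing with the `i`-th component of the field and
  -- reading off the `i`-th coordinate gives the diagonal terms; their sum over `i` is the
  -- divergence.
  have key : ∀ i : Fin N, ∫ x, u x * (H (‖x‖ ^ 2) + 2 * deriv H (‖x‖ ^ 2) * x i ^ 2)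
      = - ∫ x, (H (‖x‖ ^ 2) * x i) * g x i := by
    intro i
    have h := congrArg (fun v : Eu N => (EuclideanSpace.proj i : Eu N →L[ℝ] ℝ) v)
      (hg.integral_eq _ (htest i))
    simp only [map_neg] at h
    rw [← ContinuousLinearMap.integral_comp_comm _ (hint2 i),
      ← ContinuousLinearMap.integral_comp_comm _ (hint1 i)] at h
    simpa [gradient_comp_norm_sq_mul_coord (hH.differentiable (by simp))] using h
  have hI1 : ∀ i : Fin N, Integrable (fun x => (H (‖x‖ ^ 2) * x i) * g x i) := fun i => by
    simpa using (EuclideanSpace.proj i : Eu N →L[ℝ] ℝ).integrable_comp (hint1 i)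
  have hI2 : ∀ i : Fin N,
      Integrable (fun x => u x * (H (‖x‖ ^ 2) + 2 * deriv H (‖x‖ ^ 2) * x i ^ 2)) := fun i => by
    simpa [gradient_comp_norm_sq_mul_coord (hH.differentiable (by simp))] using
      (EuclideanSpace.proj i : Eu N →L[ℝ] ℝ).integrable_comp (hint2 i)
  calc ∫ x, inner ℝ (g x) (H (‖x‖ ^ 2) • x)
      = ∫ x, ∑ i, (H (‖x‖ ^ 2) * x i) * g x i := by
        simp [PiLp.inner_apply]
    _ = ∑ i, ∫ x, (H (‖x‖ ^ 2) * x i) * g x i := integral_finsetSum _ (fun i _ => hI1 i)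
    _ = - ∑ i, ∫ x, u x * (H (‖x‖ ^ 2) + 2 * deriv H (‖x‖ ^ 2) * x i ^ 2) := by
        rw [Finset.sum_congr rfl (fun i _ => key i)]
        simp
    _ = - ∫ x, ∑ i, u x * (H (‖x‖ ^ 2) + 2 * deriv H (‖x‖ ^ 2) * x i ^ 2) := by
        rw [integral_finsetSum _ (fun i _ => hI2 i)]
    _ = _ := by
        congr 2 with x
        rw [← Finset.mul_sum, Finset.sum_add_distrib, ← Finset.mul_sum,
          ← EuclideanSpace.real_norm_sq_eq]
        simp
        ring_nf
        simp

theorem integrable_mul_comp_norm_sq {N : ℕ} {ρ : ℝ} {u : Eu N → ℝ}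
    (hu : LocallyIntegrableOn u (Metric.closedBall (0 : Eu N) ρ)ᶜ) {H : ℝ → ℝ}
    (hH : ContDiff ℝ ∞ H) (hc : HasCompactSupport H) (hs : tsupport H ⊆ Set.Ioi (ρ ^ 2)) :
    Integrable (fun x => u x * H (‖x‖ ^ 2)) := by
  have ht := isTestFunction_comp_norm_sq_mul (N := N) hH hc hs (contDiff_const (c := (1 : ℝ)))
  have := integrable_smul_of_locallyIntegrableOn hu ht.contDiff.continuous ht.hasCompactSupport
    ht.tsupport_subset
  simpa [mul_comm] using this

theorem HasWeakGradient.integrable_inner_radial {N : ℕ} {ρ : ℝ} {u : Eu N → ℝ}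
    {g : Eu N → Eu N} (hg : HasWeakGradient (Metric.closedBall (0 : Eu N) ρ)ᶜ u g) {H : ℝ → ℝ}
    (hH : ContDiff ℝ ∞ H) (hc : HasCompactSupport H) (hs : tsupport H ⊆ Set.Ioi (ρ ^ 2)) :
    Integrable (fun x => inner ℝ (g x) (H (‖x‖ ^ 2) • x)) := by
  have h : Integrable (fun x => ∑ i, (H (‖x‖ ^ 2) * x i) * g x i) := by
    refine integrable_finsetSum _ fun i _ => ?_
    have ht := isTestFunction_comp_norm_sq_mul (N := N) hH hc hs
      (EuclideanSpace.proj i : Eu N →L[ℝ] ℝ).contDiff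
    have h1 := integrable_smul_of_locallyIntegrableOn hg.locallyIntegrableOn_grad
      ht.contDiff.continuous ht.hasCompactSupport ht.tsupport_subset
    simpa using (EuclideanSpace.proj i : Eu N →L[ℝ] ℝ).integrable_comp h1
  simpa [PiLp.inner_apply] using h

/-! ### The radial operator and the one-dimensional inequality. -/

/-- A smooth function supported away from `(-∞, 0]`, multiplied by a real power. -/
theorem contDiff_rpow_mul {ζ : ℝ → ℝ} (hζ : ContDiff ℝ ∞ ζ) (hs : tsupport ζ ⊆ Set.Ioi 0) (p : ℝ) :
    ContDiff ℝ ∞ (fun s => s ^ p * ζ s) := by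
  rw [contDiff_iff_contDiffAt]
  intro s
  by_cases h : s ∈ tsupport ζ
  · have h0 : (0 : ℝ) < s := hs h
    exact (contDiffAt_id.rpow_const_of_ne h0.ne').mul hζ.contDiffAt
  · have h1 : ζ =ᶠ[𝓝 s] 0 := notMem_tsupport_iff_eventuallyEq.1 h
    have h2 : (fun s => s ^ p * ζ s) =ᶠ[𝓝 s] fun _ => 0 := by
      filter_upwards [h1] with t ht
      simp [ht]
    exact contDiffAt_const.congr_of_eventuallyEq h2

theorem tsupport_rpow_mul_subset (ζ : ℝ → ℝ) (p : ℝ) :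
    tsupport (fun s => s ^ p * ζ s) ⊆ tsupport ζ :=
  closure_mono fun s hs h0 => hs (by simp [h0])

theorem hasDerivAt_rpow_mul {ζ : ℝ → ℝ} (hζ : Differentiable ℝ ζ) (p : ℝ) {s : ℝ} (h : 0 < s) :
    HasDerivAt (fun s => s ^ p * ζ s) (s ^ p * deriv ζ s + p * (s ^ (p - 1) * ζ s)) s := by
  have h1 := (Real.hasDerivAt_rpow_const (p := p) (Or.inl h.ne')).mul (hζ s).hasDerivAt
  exact h1.congr_deriv (by ring)

/-- The radial form of the operator `-Δ + c|x|⁻²` applied to `|x|^(-2q) ζ(|x|²)`. -/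
theorem radial_operator_rpow_mul {ζ : ℝ → ℝ} (hζ : ContDiff ℝ ∞ ζ) (q : ℝ) {s : ℝ} (h : 0 < s) :
    4 * q * (2 * deriv (fun s => s ^ (-q) * ζ s) s)
        + 2 * s * deriv (fun t => 2 * deriv (fun s => s ^ (-q) * ζ s) t) s
        - 4 * q * (1 - q) * (s ^ (-q - 1) * ζ s)
      = 4 * (s ^ (1 - q) * deriv (deriv ζ) s) := by
  have hd : Differentiable ℝ ζ := hζ.differentiable (by simp)
  have hζ' : ContDiff ℝ ∞ (deriv ζ) := (contDiff_infty_iff_deriv.1 hζ).2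
  have hd' : Differentiable ℝ (deriv ζ) := hζ'.differentiable (by simp)
  have e1 : ∀ t : ℝ, 0 < t → deriv (fun s => s ^ (-q) * ζ s) t
      = t ^ (-q) * deriv ζ t + (-q) * (t ^ (-q - 1) * ζ t) := fun t ht =>
    (hasDerivAt_rpow_mul hd _ ht).deriv
  have e2 : deriv (fun t => 2 * deriv (fun s => s ^ (-q) * ζ s) t) s
      = 2 * ((s ^ (-q) * deriv (deriv ζ) s + (-q) * (s ^ (-q - 1) * deriv ζ s))
        + (-q) * (s ^ (-q - 1) * deriv ζ s + (-q - 1) * (s ^ (-q - 1 - 1) * ζ s))) := by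
    have : (fun t => 2 * deriv (fun s => s ^ (-q) * ζ s) t) =ᶠ[𝓝 s]
        fun t => 2 * (t ^ (-q) * deriv ζ t + (-q) * (t ^ (-q - 1) * ζ t)) := by
      filter_upwards [lt_mem_nhds h] with t ht
      rw [e1 t ht]
    rw [this.deriv_eq]
    exact (((hasDerivAt_rpow_mul hd' _ h).add
      ((hasDerivAt_rpow_mul hd _ h).const_mul (-q))).const_mul 2).deriv
  rw [e2, e1 s h]
  -- All real powers are written as the lowest one times a natural power of `s`, after which the
  -- identity is polynomial.
  have r1 : s ^ (1 - q) = s ^ (-q - 1 - 1) * s ^ 3 := by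
    rw [← Real.rpow_natCast, ← Real.rpow_add h]; congr 1; push_cast; ring
  have r2 : s ^ (-q) = s ^ (-q - 1 - 1) * s ^ 2 := by
    rw [← Real.rpow_natCast, ← Real.rpow_add h]; congr 1; push_cast; ring
  have r3 : s ^ (-q - 1) = s ^ (-q - 1 - 1) * s := by
    rw [← Real.rpow_add_one h.ne']; congr 1; ring
  rw [r1, r2, r3]
  ring

theorem tsupport_deriv_subset_tsupport (ζ : ℝ → ℝ) : tsupport (deriv ζ) ⊆ tsupport ζ :=
  closure_minimal support_deriv_subset (isClosed_tsupport _)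

/-- A nonnegative supersolution tested with `|x|^(-N/2) ζ(|x|²)`. -/
theorem integral_mul_deriv_deriv_nonpos {N : ℕ} {ρ : ℝ} {V u : Eu N → ℝ}
    (hV : MemLinftyLoc (Metric.ball 0 ρ)ᶜ V)
    (hVle : ∀ᵐ x : Eu N, ρ ≤ ‖x‖ → V x ≤ (N : ℝ) * (4 - (N : ℝ)) / 4 * (‖x‖ ^ 2)⁻¹)
    (hu0 : ∀ᵐ x : Eu N, ρ ≤ ‖x‖ → 0 ≤ u x)
    (hAu : IsWeakSupersolution (Metric.closedBall 0 ρ)ᶜ V u) {ζ : ℝ → ℝ} (hζ : ContDiff ℝ ∞ ζ)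
    (hc : HasCompactSupport ζ) (hs : tsupport ζ ⊆ Set.Ioi (ρ ^ 2)) (h0 : ∀ s, 0 ≤ ζ s) :
    ∫ x, u x * ((‖x‖ ^ 2) ^ (1 - (N : ℝ) / 4) * deriv (deriv ζ) (‖x‖ ^ 2)) ≤ 0 := by
  obtain ⟨g, hg, hpos⟩ := hAu
  set q : ℝ := (N : ℝ) / 4 with hq
  have hs0 : tsupport ζ ⊆ Set.Ioi 0 := hs.trans (Set.Ioi_subset_Ioi (sq_nonneg ρ))
  set G : ℝ → ℝ := fun s => s ^ (-q) * ζ s with hG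
  have hGs : tsupport G ⊆ tsupport ζ := tsupport_rpow_mul_subset ζ _
  have hGc : HasCompactSupport G := hc.mono' (subset_closure.trans hGs)
  have hGd : ContDiff ℝ ∞ G := contDiff_rpow_mul hζ hs0 _
  -- The gradient of `G(|x|²)` is the radial field `H(|x|²) x`, so the gradient term can be
  -- integrated by parts with `integral_inner_radial`.
  set H : ℝ → ℝ := fun s => 2 * deriv G s with hH
  have hHd : ContDiff ℝ ∞ H := contDiff_const.mul (contDiff_infty_iff_deriv.1 hGd).2
  have hHs : tsupport H ⊆ tsupport ζ := by
    refine closure_minimal (fun s h => hGs (tsupport_deriv_subset_tsupport G (subset_closure ?_)))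
      (isClosed_tsupport _)
    intro h0
    exact h (by simp [hH, h0])
  have hHc : HasCompactSupport H := hc.mono' (subset_closure.trans hHs)
  have hζ''s : tsupport (deriv (deriv ζ)) ⊆ tsupport ζ :=
    (tsupport_deriv_subset_tsupport _).trans (tsupport_deriv_subset_tsupport _)
  have test : IsTestFunction (Metric.closedBall (0 : Eu N) ρ)ᶜ (fun x => G (‖x‖ ^ 2)) := by
    simpa using isTestFunction_comp_norm_sq_mul (N := N) hGd hGc (hGs.trans hs)
      (contDiff_const (c := (1 : ℝ)))
  have hGpos : ∀ x : Eu N, 0 ≤ G (‖x‖ ^ 2) := fun x =>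
    mul_nonneg (Real.rpow_nonneg (sq_nonneg _) _) (h0 _)
  have hmain := hpos _ test hGpos
  have hgrad : ∀ x : Eu N, gradient (fun x : Eu N => G (‖x‖ ^ 2)) x = H (‖x‖ ^ 2) • x := fun x =>
    (hasGradientAt_comp_norm_sq ((hGd.differentiable (by simp)) _).hasDerivAt).gradient
  simp only [hgrad] at hmain
  have hi1 := hg.integrable_inner_radial hHd hHc (hHs.trans hs)
  -- the potential term
  have hi2 : Integrable (fun x => V x * u x * G (‖x‖ ^ 2)) := by
    set K := tsupport (fun x : Eu N => G (‖x‖ ^ 2))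
    have hK : IsCompact K := test.hasCompactSupport
    have hKs : K ⊆ (Metric.ball (0 : Eu N) ρ)ᶜ :=
      test.tsupport_subset.trans (Set.compl_subset_compl.2 Metric.ball_subset_closedBall)
    have h1 : Integrable (fun x => u x * G (‖x‖ ^ 2)) (volume.restrict K) :=
      (integrable_mul_comp_norm_sq hg.locallyIntegrableOn hGd hGc (hGs.trans hs)).integrableOn
    have h2 := h1.mul_of_top_right (hV K hKs hK)
    refine (integrableOn_iff_integrable_of_support_subset (s := K) ?_).1
      (h2.congr (ae_of_all _ fun x => ?_))
    · intro x hx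
      apply subset_tsupport
      intro h0
      exact hx (by simp [h0])
    · simp [mul_assoc]
  set P : ℝ → ℝ := fun s => 4 * q * (1 - q) * (s ^ (-q - 1) * ζ s) with hP
  have hPd : ContDiff ℝ ∞ P := contDiff_const.mul (contDiff_rpow_mul hζ hs0 _)
  have hPs : tsupport P ⊆ tsupport ζ := closure_mono fun s hs h0 => hs (by simp [hP, h0])
  have hPc : HasCompactSupport P := hc.mono' (subset_closure.trans hPs)
  have hi3 := integrable_mul_comp_norm_sq hg.locallyIntegrableOn hPd hPc (hPs.trans hs)
  -- `P` is `G` multiplied by the extremal potential `c/s`, since `4q(1-q) = N(4-N)/4`. The bound on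
  -- `V` and the sign of `u` are needed only where `G ≠ 0`, hence only outside the closed ball.
  have hle : ∫ x, V x * u x * G (‖x‖ ^ 2) ≤ ∫ x, u x * P (‖x‖ ^ 2) := by
    refine integral_mono_ae hi2 hi3 ?_
    filter_upwards [hVle, hu0] with x hx1 hx2
    by_cases hx : G (‖x‖ ^ 2) = 0
    · have hz : P (‖x‖ ^ 2) = 0 := by
        rcases mul_eq_zero.1 hx with h | h
        · rcases (Real.rpow_eq_zero_iff_of_nonneg (sq_nonneg ‖x‖)).1 h with ⟨h, -⟩
          have : ζ 0 = 0 := image_eq_zero_of_notMem_tsupport fun h => lt_irrefl (0 : ℝ) (hs0 h)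
          simp [hP, h, this]
        · simp [hP, h]
      simp [hx, hz]
    · have hxρ : x ∈ (Metric.closedBall (0 : Eu N) ρ)ᶜ :=
        test.tsupport_subset (subset_tsupport _ hx)
      simp only [Set.mem_compl_iff, mem_closedBall_zero_iff, not_le] at hxρ
      have hxs : 0 < ‖x‖ ^ 2 := hs0 (hGs (subset_tsupport _ hx))
      have hP' : P (‖x‖ ^ 2) = (N : ℝ) * (4 - (N : ℝ)) / 4 * (‖x‖ ^ 2)⁻¹ * G (‖x‖ ^ 2) := by
        simp only [hP, hG]
        rw [Real.rpow_sub_one hxs.ne', hq]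
        ring
      rw [hP']
      have h1 := mul_le_mul_of_nonneg_right (hx1 hxρ.le) (mul_nonneg (hx2 hxρ.le) (hGpos x))
      linarith
  have hNH : Integrable (fun x : Eu N =>
      u x * (N * H (‖x‖ ^ 2) + 2 * ‖x‖ ^ 2 * deriv H (‖x‖ ^ 2))) := by
    have hd : ContDiff ℝ ∞ (fun s => N * H s + 2 * s * deriv H s) :=
      (contDiff_const.mul hHd).add
        ((contDiff_const.mul contDiff_id).mul (contDiff_infty_iff_deriv.1 hHd).2)
    have hs' : tsupport (fun s => N * H s + 2 * s * deriv H s) ⊆ tsupport ζ := by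
      refine closure_minimal (fun s h => ?_) (isClosed_tsupport _)
      by_contra hn
      have e1 : H s = 0 := image_eq_zero_of_notMem_tsupport fun h => hn (hHs h)
      have e2 : deriv H s = 0 := image_eq_zero_of_notMem_tsupport fun h =>
        hn (hHs (tsupport_deriv_subset_tsupport H h))
      exact h (by simp [e1, e2])
    exact integrable_mul_comp_norm_sq hg.locallyIntegrableOn hd
      (hc.mono' (subset_closure.trans hs')) (hs'.trans hs)
  rw [integral_add hi1 hi2, hg.integral_inner_radial hHd hHc (hHs.trans hs)] at hmain
  have hfin : (∫ x, u x * (N * H (‖x‖ ^ 2) + 2 * ‖x‖ ^ 2 * deriv H (‖x‖ ^ 2)))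
      - ∫ x, u x * P (‖x‖ ^ 2)
      = 4 * ∫ x, u x * ((‖x‖ ^ 2) ^ (1 - q) * deriv (deriv ζ) (‖x‖ ^ 2)) := by
    rw [← integral_sub hNH hi3, ← integral_const_mul]
    congr 1 with x
    rcases eq_or_ne (‖x‖ ^ 2) 0 with h | h
    · have hn : (0 : ℝ) ∉ tsupport ζ := fun h => lt_irrefl (0 : ℝ) (hs0 h)
      have e1 : H 0 = 0 := image_eq_zero_of_notMem_tsupport fun h => hn (hHs h)
      have e2 : ζ 0 = 0 := image_eq_zero_of_notMem_tsupport hn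
      have e3 : deriv (deriv ζ) 0 = 0 := image_eq_zero_of_notMem_tsupport fun h => hn (hζ''s h)
      simp [h, e1, e2, e3, hP]
    · have := radial_operator_rpow_mul hζ q (lt_of_le_of_ne (sq_nonneg ‖x‖) h.symm)
      have hN : (N : ℝ) = 4 * q := by rw [hq]; ring
      rw [← mul_sub, hN, mul_left_comm (4 : ℝ) (u x), ← this]
  linarith

/-! ### Tails of `L²` functions, and bumps as approximate second derivatives of bumps. -/

/-- The `L^2` norm of an `L^2` function outside a large ball tends to zero. -/
theorem tendsto_eLpNorm_indicator_compl_ball {N : ℕ} {F : Type*} [NormedAddCommGroup F]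
    [NormedSpace ℝ F] {f : Eu N → F} (hf : MemLp f 2) :
    Tendsto (fun n : ℕ => eLpNorm ((Metric.ball (0 : Eu N) n)ᶜ.indicator f) 2 volume)
      atTop (𝓝 0) := by
  rw [ENNReal.tendsto_nhds_zero]
  intro ε hε
  obtain ⟨h, hc, hle, -, -⟩ := hf.exists_hasCompactSupport_eLpNorm_sub_le (by simp) hε.ne'
  obtain ⟨R, hR⟩ := hc.isBounded.subset_ball (0 : Eu N)
  obtain ⟨n₀, hn₀⟩ := exists_nat_ge R
  filter_upwards [eventually_ge_atTop n₀] with n hn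
  refine le_trans (le_trans (le_of_eq ?_) (eLpNorm_indicator_le (s := (Metric.ball (0 : Eu N) n)ᶜ)
    (f - h))) hle
  congr 1
  ext1 x
  by_cases hx : x ∈ (Metric.ball (0 : Eu N) n)ᶜ
  · have : h x = 0 := by
      apply image_eq_zero_of_notMem_tsupport
      intro hx'
      have h1 : (n₀ : ℝ) ≤ n := by exact_mod_cast hn
      exact hx (Metric.ball_subset_ball (hn₀.trans h1) (hR hx'))
    simp [Set.indicator_of_mem hx, this]
  · simp [Set.indicator_of_notMem hx]

theorem exists_hasDerivAt_of_contDiff {f : ℝ → ℝ} (hf : ContDiff ℝ ∞ f) (a : ℝ) :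
    ∃ F : ℝ → ℝ, ContDiff ℝ ∞ F ∧ deriv F = f ∧ F a = 0 := by
  have hd : ∀ s, HasDerivAt (fun s => ∫ t in a..s, f t) (f s) s := fun s =>
    hf.continuous.integral_hasStrictDerivAt a s |>.hasDerivAt
  have he : deriv (fun s => ∫ t in a..s, f t) = f := funext fun s => (hd s).deriv
  refine ⟨fun s => ∫ t in a..s, f t, ?_, he, by simp⟩
  rw [contDiff_infty_iff_deriv, he]
  exact ⟨fun s => (hd s).differentiableAt, hf⟩

theorem eq_zero_of_deriv_eq_zero_Iic {F : ℝ → ℝ} {a : ℝ} (hF : Differentiable ℝ F)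
    (h : ∀ s ≤ a, deriv F s = 0) (ha : F a = 0) {s : ℝ} (hs : s ≤ a) : F s = 0 := by
  have h1 := (convex_Iic a).is_const_of_fderivWithin_eq_zero (𝕜 := ℝ) (f := F)
    hF.differentiableOn (fun x hx => ?_) hs (Set.mem_Iic.2 le_rfl)
  · rw [h1, ha]
  · rw [fderivWithin_eq_fderiv ((uniqueDiffOn_Iic a) x hx) (hF x)]
    ext
    simp [h x hx]

/-- The second primitive of a nonnegative bump: convex, of linear growth. -/
theorem exists_convex_primitive {f : ℝ → ℝ} (hf : ContDiff ℝ ∞ f) (hf0 : ∀ s, 0 ≤ f s) {a b : ℝ}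
    (ha : 0 ≤ a) (hfa : ∀ s ≤ a, f s = 0) (hfb : ∀ s, b ≤ s → f s = 0) :
    ∃ Z : ℝ → ℝ, ∃ C : ℝ, ContDiff ℝ ∞ Z ∧ deriv (deriv Z) = f ∧ (∀ s, 0 ≤ Z s) ∧
      (∀ s ≤ a, Z s = 0) ∧ 0 ≤ C ∧ (∀ s, |deriv Z s| ≤ C) ∧ (∀ s, 0 ≤ s → Z s ≤ C * s) := by
  obtain ⟨F, hF, hFd, hFa⟩ := exists_hasDerivAt_of_contDiff hf a
  obtain ⟨Z, hZ, hZd, hZa⟩ := exists_hasDerivAt_of_contDiff hF a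
  have hFdiff : Differentiable ℝ F := hF.differentiable (by simp)
  have hZdiff : Differentiable ℝ Z := hZ.differentiable (by simp)
  have hFz : ∀ s ≤ a, F s = 0 := fun s hs =>
    eq_zero_of_deriv_eq_zero_Iic hFdiff (by rw [hFd]; exact hfa) hFa hs
  have hZz : ∀ s ≤ a, Z s = 0 := fun s hs =>
    eq_zero_of_deriv_eq_zero_Iic hZdiff (by rw [hZd]; exact hFz) hZa hs
  have hFm : Monotone F := monotone_of_deriv_nonneg hFdiff (by rw [hFd]; exact hf0)
  have hF0 : ∀ s, 0 ≤ F s := fun s => by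
    rcases le_total s a with h | h
    · rw [hFz s h]
    · rw [← hFa]; exact hFm h
  have hZm : Monotone Z := monotone_of_deriv_nonneg hZdiff (by rw [hZd]; exact hF0)
  have hZ0 : ∀ s, 0 ≤ Z s := fun s => by
    rcases le_total s a with h | h
    · rw [hZz s h]
    · rw [← hZa]; exact hZm h
  have hFb : ∀ s, F s ≤ F b := fun s => by
    rcases le_total s b with h | h
    · exact hFm h
    · refine le_of_eq ?_
      have h1 := (convex_Ici b).is_const_of_fderivWithin_eq_zero (𝕜 := ℝ) (f := F)
        hFdiff.differentiableOn (fun x hx => ?_) h (Set.mem_Ici.2 le_rfl)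
      · exact h1
      · rw [fderivWithin_eq_fderiv ((uniqueDiffOn_Ici b) x hx) (hFdiff x)]
        ext
        simp [hFd, hfb x hx]
  -- The slope `F = Z'` increases up to `b` and is constant afterwards, so `F b`, the total mass of
  -- `f`, is the optimal bound.
  refine ⟨Z, F b, hZ, by rw [hZd, hFd], hZ0, hZz, hF0 b, fun s => ?_, fun s hs => ?_⟩
  · rw [hZd, abs_of_nonneg (hF0 s)]
    exact hFb s
  · have h1 := (convex_Ici (0 : ℝ)).image_sub_le_mul_sub_of_deriv_le (f := Z) (C := F b)
      hZdiff.continuous.continuousOn hZdiff.differentiableOn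
      (fun x _ => by rw [hZd]; exact hFb x) 0 (Set.mem_Ici.2 le_rfl) s hs hs
    rw [hZz 0 ha] at h1
    linarith

/-- A smooth cutoff on the line, equal to `1` below `1` and to `0` above `2`. -/
theorem exists_cutoff : ∃ χ : ℝ → ℝ, ∃ C : ℝ, ContDiff ℝ ∞ χ ∧ (∀ s, 0 ≤ χ s) ∧
    (∀ s ≤ 1, χ s = 1) ∧ (∀ s, 2 ≤ s → χ s = 0) ∧ 0 ≤ C ∧
    (∀ s, |deriv χ s| ≤ C) ∧ (∀ s, |deriv (deriv χ) s| ≤ C) ∧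
    (∀ s ∉ Set.Icc (1 : ℝ) 2, deriv χ s = 0 ∧ deriv (deriv χ) s = 0) := by
  set χ : ℝ → ℝ := fun s => Real.smoothTransition (2 - s) with hχ
  have hd : ContDiff ℝ ∞ χ := Real.smoothTransition.contDiff.comp (contDiff_const.sub contDiff_id)
  have hd1 := (contDiff_infty_iff_deriv.1 hd).2
  have hd2 := (contDiff_infty_iff_deriv.1 hd1).2
  have h1 : ∀ s ≤ 1, χ s = 1 := fun s hs => Real.smoothTransition.one_of_one_le (by linarith)
  have h2 : ∀ s, 2 ≤ s → χ s = 0 := fun s hs => Real.smoothTransition.zero_of_nonpos (by linarith)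
  have hloc : ∀ s ∉ Set.Icc (1 : ℝ) 2, ∃ c : ℝ, χ =ᶠ[𝓝 s] fun _ => c := by
    intro s hs
    rcases lt_or_ge s 1 with h | h
    · exact ⟨1, by filter_upwards [gt_mem_nhds h] with t ht using h1 t ht.le⟩
    · have h3 : 2 < s := by
        by_contra h4
        exact hs ⟨h, not_lt.1 h4⟩
      exact ⟨0, by filter_upwards [lt_mem_nhds h3] with t ht using h2 t ht.le⟩
  have hz : ∀ s ∉ Set.Icc (1 : ℝ) 2, deriv χ s = 0 ∧ deriv (deriv χ) s = 0 := by
    intro s hs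
    obtain ⟨c, hc⟩ := hloc s hs
    refine ⟨by rw [hc.deriv_eq]; simp, ?_⟩
    rw [hc.deriv.deriv_eq]
    simp
  obtain ⟨C1, hC1⟩ := isCompact_Icc.exists_bound_of_continuousOn (s := Set.Icc (1 : ℝ) 2)
    hd1.continuous.continuousOn
  obtain ⟨C2, hC2⟩ := isCompact_Icc.exists_bound_of_continuousOn (s := Set.Icc (1 : ℝ) 2)
    hd2.continuous.continuousOn
  have hC1' : 0 ≤ C1 := (norm_nonneg _).trans (hC1 1 (by norm_num))
  have hC2' : 0 ≤ C2 := (norm_nonneg _).trans (hC2 1 (by norm_num))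
  refine ⟨χ, C1 + C2, hd, fun s => Real.smoothTransition.nonneg _, h1, h2, by positivity,
    fun s => ?_, fun s => ?_, hz⟩
  · by_cases hs : s ∈ Set.Icc (1 : ℝ) 2
    · have := hC1 s hs
      rw [Real.norm_eq_abs] at this
      linarith
    · rw [(hz s hs).1]; simp; positivity
  · by_cases hs : s ∈ Set.Icc (1 : ℝ) 2
    · have := hC2 s hs
      rw [Real.norm_eq_abs] at this
      linarith
    · rw [(hz s hs).2]; simp; positivity

/-- Every nonnegative bump is, up to an error of size `C / R` on `[R, 2R]`, the second derivative of
a nonnegative bump. -/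
theorem exists_cutoff_primitive {f : ℝ → ℝ} (hf : ContDiff ℝ ∞ f) (hf0 : ∀ s, 0 ≤ f s) {a b : ℝ}
    (ha : 0 ≤ a) (hfa : ∀ s ≤ a, f s = 0) (hfb : ∀ s, b ≤ s → f s = 0) :
    ∃ C : ℝ, 0 ≤ C ∧ ∀ R : ℝ, 0 < R → b ≤ R → ∃ ζ : ℝ → ℝ, ContDiff ℝ ∞ ζ ∧ HasCompactSupport ζ ∧
      tsupport ζ ⊆ Set.Ici a ∧ (∀ s, 0 ≤ ζ s) ∧
      ∀ s, |deriv (deriv ζ) s - f s| ≤ (Set.Icc R (2 * R)).indicator (fun _ => C / R) s := by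
  obtain ⟨Z, C, hZ, hZd, hZ0, hZa, hC, hZ1, hZ2⟩ := exists_convex_primitive hf hf0 ha hfa hfb
  obtain ⟨χ, D, hχ, hχ0, hχ1, hχ2, hD, hχd, hχdd, hχz⟩ := exists_cutoff
  -- The two cross terms `Z'χ'/R` contribute `CD/R` each. The term `Zχ''/R²` contributes `2CD/R`,
  -- because `Z ≤ C·2R` on `[R,2R]`.
  refine ⟨4 * C * D, by positivity, fun R hR hbR => ?_⟩
  have hsupp : Function.support (fun s => Z s * χ (s / R)) ⊆ Set.Icc a (2 * R) := by
    intro s hs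
    constructor
    · by_contra h
      exact hs (by simp [hZa s (not_le.1 h).le])
    · by_contra h
      have h1 : 2 ≤ s / R := by rw [le_div_iff₀ hR]; exact (not_le.1 h).le
      exact hs (by simp [hχ2 _ h1])
  have hχR : ContDiff ℝ ∞ (fun s => χ (s / R)) := hχ.comp (contDiff_id.div_const R)
  refine ⟨fun s => Z s * χ (s / R), hZ.mul hχR,
    HasCompactSupport.of_support_subset_isCompact isCompact_Icc hsupp,
    (closure_minimal hsupp isClosed_Icc).trans Set.Icc_subset_Ici_self,
    fun s => mul_nonneg (hZ0 s) (hχ0 _), fun s => ?_⟩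
  have hχ' := (contDiff_infty_iff_deriv.1 hχ).2
  have hZ' := (contDiff_infty_iff_deriv.1 hZ).2
  have hdiv : ∀ t : ℝ, HasDerivAt (fun s : ℝ => s / R) (1 / R) t := fun t =>
    (hasDerivAt_id t).div_const R
  have d1 : ∀ t, HasDerivAt (fun s => χ (s / R)) (deriv χ (t / R) * (1 / R)) t := fun t =>
    ((hχ.differentiable (by simp)) (t / R)).hasDerivAt.comp t (hdiv t)
  have d2 : ∀ t, HasDerivAt (fun s => deriv χ (s / R)) (deriv (deriv χ) (t / R) * (1 / R)) t :=
    fun t => HasDerivAt.comp (h₂ := deriv χ) t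
      ((hχ'.differentiable (by simp)) (t / R)).hasDerivAt (hdiv t)
  have z1 : ∀ t, HasDerivAt Z (deriv Z t) t := fun t =>
    ((hZ.differentiable (by simp)) t).hasDerivAt
  have z2 : ∀ t, HasDerivAt (deriv Z) (f t) t := fun t => by
    rw [← hZd]; exact ((hZ'.differentiable (by simp)) t).hasDerivAt
  have e1 : deriv (fun s => Z s * χ (s / R))
      = fun t => deriv Z t * χ (t / R) + Z t * (deriv χ (t / R) * (1 / R)) :=
    funext fun t => ((z1 t).mul (d1 t)).deriv
  have e2 : deriv (deriv (fun s => Z s * χ (s / R))) s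
      = (f s * χ (s / R) + deriv Z s * (deriv χ (s / R) * (1 / R)))
        + (deriv Z s * (deriv χ (s / R) * (1 / R))
          + Z s * (deriv (deriv χ) (s / R) * (1 / R) * (1 / R))) := by
    rw [e1]
    exact (((z2 s).mul (d1 s)).add ((z1 s).mul ((d2 s).mul_const (1 / R)))).deriv
  -- The cutoff does not touch `f`: `f` vanishes from `b` on, and `χ(s/R) = 1` for `s ≤ R`, where `b
  -- ≤ R`.
  have e3 : f s * χ (s / R) = f s := by
    rcases le_total b s with h | h
    · simp [hfb s h]
    · rw [hχ1 _ ((div_le_one hR).2 (h.trans hbR)), mul_one]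
  rw [e2, e3]
  by_cases hs : s ∈ Set.Icc R (2 * R)
  · rw [Set.indicator_of_mem hs]
    have hsp : 0 ≤ s := hR.le.trans hs.1
    have b1 : |deriv Z s * (deriv χ (s / R) * (1 / R))| ≤ C * (D * (1 / R)) := by
      rw [abs_mul, abs_mul, abs_of_pos (by positivity : 0 < 1 / R)]
      gcongr
      · exact hZ1 s
      · exact hχd _
    have b2 : |Z s * (deriv (deriv χ) (s / R) * (1 / R) * (1 / R))|
        ≤ C * (2 * R) * (D * (1 / R) * (1 / R)) := by
      rw [abs_mul, abs_mul, abs_mul, abs_of_pos (by positivity : 0 < 1 / R), abs_of_nonneg (hZ0 s)]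
      have hb : Z s ≤ C * (2 * R) :=
        (hZ2 s hsp).trans (mul_le_mul_of_nonneg_left hs.2 hC)
      gcongr
      exact hχdd _
    have b3 : C * (2 * R) * (D * (1 / R) * (1 / R)) = 2 * (C * (D * (1 / R))) := by
      field_simp
    have b4 : 4 * C * D / R = 4 * (C * (D * (1 / R))) := by
      field_simp
    rw [b3] at b2
    rw [b4]
    rw [abs_le] at *
    constructor <;> linarith [b1.1, b1.2, b2.1, b2.2]
  · rw [Set.indicator_of_notMem hs]
    have hs' : s / R ∉ Set.Icc (1 : ℝ) 2 := by
      intro h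
      refine hs ⟨?_, ?_⟩
      · have := h.1; rwa [le_div_iff₀ hR, one_mul] at this
      · have := h.2; rwa [div_le_iff₀ hR] at this
    rw [(hχz _ hs').1, (hχz _ hs').2]
    simp

/-! ### Vanishing of the supersolution outside the ball. -/

/-- Hölder's inequality on an annulus. -/
theorem lintegral_annulus_le {N : ℕ} {u : Eu N → ℝ} (hu : MemLp u 2) {n : ℕ} (hn : 0 < n) {R : ℝ}
    (hR : R = (n : ℝ) ^ 2) :
    ∫⁻ x in {x : Eu N | ‖x‖ ^ 2 ∈ Set.Icc R (2 * R)}, ‖u x‖ₑ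
      ≤ eLpNorm ((Metric.ball (0 : Eu N) n)ᶜ.indicator u) 2 volume
        * (ENNReal.ofReal ((2 * R) ^ ((N : ℝ) / 4))
          * volume (Metric.ball (0 : Eu N) 1) ^ ((1 : ℝ) / 2)) := by
  set A := {x : Eu N | ‖x‖ ^ 2 ∈ Set.Icc R (2 * R)} with hA
  have hRpos : 0 < R := by rw [hR]; positivity
  have hAm : MeasurableSet A := by
    have : Measurable (fun x : Eu N => ‖x‖ ^ 2) := by fun_prop
    exact this measurableSet_Icc
  have hsub : A ⊆ (Metric.ball (0 : Eu N) n)ᶜ := by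
    intro x hx h
    rw [mem_ball_zero_iff] at h
    have h1 : R ≤ ‖x‖ ^ 2 := hx.1
    rw [hR] at h1
    have h2 := pow_lt_pow_left₀ h (norm_nonneg _) two_ne_zero
    linarith
  have h1 : ∫⁻ x in A, ‖u x‖ₑ = eLpNorm u 1 (volume.restrict A) := eLpNorm_one_eq_lintegral_enorm.symm
  have h2 := eLpNorm_le_eLpNorm_mul_rpow_measure_univ (p := 1) (q := 2) (by norm_num)
    (hu.1.restrict (s := A))
  rw [h1]
  refine h2.trans ?_
  have h3 : eLpNorm u 2 (volume.restrict A)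
      ≤ eLpNorm ((Metric.ball (0 : Eu N) n)ᶜ.indicator u) 2 volume := by
    rw [eLpNorm_indicator_eq_eLpNorm_restrict measurableSet_ball.compl]
    exact eLpNorm_mono_measure _ (Measure.restrict_mono hsub le_rfl)
  have h4 : volume A ≤ ENNReal.ofReal (Real.sqrt (2 * R) ^ N) * volume (Metric.ball (0 : Eu N) 1) := by
    have : A ⊆ Metric.closedBall (0 : Eu N) (Real.sqrt (2 * R)) := by
      intro x hx
      rw [mem_closedBall_zero_iff]
      exact Real.le_sqrt_of_sq_le hx.2
    refine (measure_mono this).trans (le_of_eq ?_)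
    rw [Measure.addHaar_closedBall _ _ (Real.sqrt_nonneg _)]
    simp
  refine mul_le_mul' h3 ?_
  rw [Measure.restrict_apply_univ]
  have h5 : (1 / (1 : ENNReal).toReal - 1 / (2 : ENNReal).toReal) = (1 : ℝ) / 2 := by norm_num
  rw [h5]
  refine (ENNReal.rpow_le_rpow h4 (by norm_num)).trans (le_of_eq ?_)
  rw [ENNReal.mul_rpow_of_nonneg _ _ (by norm_num), ENNReal.ofReal_rpow_of_nonneg (by positivity)
    (by norm_num)]
  congr 2
  rw [Real.sqrt_eq_rpow, ← Real.rpow_natCast, ← Real.rpow_mul (by positivity),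
    ← Real.rpow_mul (by positivity)]
  congr 1
  ring

/-- The quantitative form of "nonnegative, concave and square-integrable implies zero". The bump is
replaced by `ζ''`, for which the inequality is known; the error on the annulus `R ≤ |x|² ≤ 2R` is a
constant times the `L²` norm of `u` outside the ball of radius `√R`, and tends to zero. -/
theorem integral_mul_bump_nonpos {N : ℕ} (hN : N ≤ 4) {ρ : ℝ} {V u : Eu N → ℝ}
    (hV : MemLinftyLoc (Metric.ball 0 ρ)ᶜ V)
    (hVle : ∀ᵐ x : Eu N, ρ ≤ ‖x‖ → V x ≤ (N : ℝ) * (4 - (N : ℝ)) / 4 * (‖x‖ ^ 2)⁻¹)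
    (hu : MemLp u 2) (hu0 : ∀ᵐ x : Eu N, ρ ≤ ‖x‖ → 0 ≤ u x)
    (hAu : IsWeakSupersolution (Metric.closedBall 0 ρ)ᶜ V u) {f : ℝ → ℝ} (hf : ContDiff ℝ ∞ f)
    (hf0 : ∀ s, 0 ≤ f s) {a b : ℝ} (ha : ρ ^ 2 < a) (hfa : ∀ s ≤ a, f s = 0)
    (hfb : ∀ s, b ≤ s → f s = 0) :
    Integrable (fun x => u x * ((‖x‖ ^ 2) ^ (1 - (N : ℝ) / 4) * f (‖x‖ ^ 2))) ∧
    ∫ x, u x * ((‖x‖ ^ 2) ^ (1 - (N : ℝ) / 4) * f (‖x‖ ^ 2)) ≤ 0 := by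
  have ha0 : 0 ≤ a := (sq_nonneg ρ).trans ha.le
  have hqN : (N : ℝ) / 4 ≤ 1 := by
    have : (N : ℝ) ≤ 4 := by exact_mod_cast hN
    linarith
  have hlu : LocallyIntegrableOn u (Metric.closedBall (0 : Eu N) ρ)ᶜ := by
    obtain ⟨g, hg, -⟩ := hAu
    exact hg.locallyIntegrableOn
  have hint : ∀ h : ℝ → ℝ, ContDiff ℝ ∞ h → HasCompactSupport h → tsupport h ⊆ Set.Ici a →
      Integrable (fun x => u x * ((‖x‖ ^ 2) ^ (1 - (N : ℝ) / 4) * h (‖x‖ ^ 2))) := by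
    intro h hd hc hs
    have hs' : tsupport h ⊆ Set.Ioi (ρ ^ 2) := hs.trans (Set.Ici_subset_Ioi.2 ha)
    have hsub := tsupport_rpow_mul_subset h (1 - (N : ℝ) / 4)
    exact integrable_mul_comp_norm_sq (H := fun s => s ^ (1 - (N : ℝ) / 4) * h s) hlu
      (contDiff_rpow_mul hd (hs'.trans (Set.Ioi_subset_Ioi (sq_nonneg ρ))) _)
      (hc.mono' (subset_closure.trans hsub)) (hsub.trans hs')
  have hfs : Function.support f ⊆ Set.Icc a b := by
    intro s hs
    constructor
    · by_contra h
      exact hs (hfa s (not_le.1 h).le)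
    · by_contra h
      exact hs (hfb s (not_le.1 h).le)
  have hfi := hint f hf (HasCompactSupport.of_support_subset_isCompact isCompact_Icc hfs)
    ((closure_minimal hfs isClosed_Icc).trans Set.Icc_subset_Ici_self)
  refine ⟨hfi, ?_⟩
  obtain ⟨C, hC, hprim⟩ := exists_cutoff_primitive hf hf0 ha0 hfa hfb
  set I := ∫ x, u x * ((‖x‖ ^ 2) ^ (1 - (N : ℝ) / 4) * f (‖x‖ ^ 2)) with hI
  set κ := volume (Metric.ball (0 : Eu N) 1) ^ ((1 : ℝ) / 2) with hκ
  have hκt : κ ≠ ⊤ := ENNReal.rpow_ne_top_of_nonneg (by norm_num) measure_ball_lt_top.ne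
  have hbound : ∀ᶠ n : ℕ in atTop, ENNReal.ofReal I
      ≤ (ENNReal.ofReal (2 * C) * κ) * eLpNorm ((Metric.ball (0 : Eu N) n)ᶜ.indicator u) 2 volume := by
    have h1 : ∀ᶠ n : ℕ in atTop, b ≤ (n : ℝ) ^ 2 :=
      ((tendsto_pow_atTop two_ne_zero).comp tendsto_natCast_atTop_atTop).eventually_ge_atTop b
    filter_upwards [h1, eventually_gt_atTop 0] with n hbn hn
    obtain ⟨R, hR⟩ : ∃ R : ℝ, R = (n : ℝ) ^ 2 := ⟨_, rfl⟩
    have hRpos : 0 < R := by rw [hR]; positivity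
    rw [← hR] at hbn
    obtain ⟨ζ, hζ, hζc, hζs, hζ0, hζf⟩ := hprim R hRpos hbn
    have hneg := integral_mul_deriv_deriv_nonpos hV hVle hu0 hAu hζ hζc
      (hζs.trans (Set.Ici_subset_Ioi.2 ha)) hζ0
    have hζ'' : ContDiff ℝ ∞ (deriv (deriv ζ)) :=
      (contDiff_infty_iff_deriv.1 (contDiff_infty_iff_deriv.1 hζ).2).2
    have hζ''s : tsupport (deriv (deriv ζ)) ⊆ tsupport ζ :=
      (tsupport_deriv_subset_tsupport _).trans (tsupport_deriv_subset_tsupport _)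
    have hζi := hint _ hζ'' (hζc.mono' (subset_closure.trans hζ''s)) (hζ''s.trans hζs)
    set A := {x : Eu N | ‖x‖ ^ 2 ∈ Set.Icc R (2 * R)} with hA
    have hAm : MeasurableSet A := by
      have : Measurable (fun x : Eu N => ‖x‖ ^ 2) := by fun_prop
      exact this measurableSet_Icc
    set K : ℝ := (2 * R) ^ (1 - (N : ℝ) / 4) * (C / R) with hK
    have hpt : ∀ x : Eu N, ‖u x * ((‖x‖ ^ 2) ^ (1 - (N : ℝ) / 4) * f (‖x‖ ^ 2))
        - u x * ((‖x‖ ^ 2) ^ (1 - (N : ℝ) / 4) * deriv (deriv ζ) (‖x‖ ^ 2))‖ₑ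
        ≤ A.indicator (fun x => ENNReal.ofReal K * ‖u x‖ₑ) x := by
      intro x
      have hx := hζf (‖x‖ ^ 2)
      by_cases hxA : x ∈ A
      · have hxs : ‖x‖ ^ 2 ∈ Set.Icc R (2 * R) := hxA
        rw [Set.indicator_of_mem hxA]
        rw [Set.indicator_of_mem hxs] at hx
        rw [← mul_sub, ← mul_sub, enorm_mul, mul_comm]
        gcongr
        rw [Real.enorm_eq_ofReal_abs]
        apply ENNReal.ofReal_le_ofReal
        rw [abs_mul, abs_sub_comm, abs_of_nonneg (by positivity)]
        refine mul_le_mul ?_ hx (abs_nonneg _) (by positivity)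
        -- The exponent `1 - N/4` is nonnegative because `N ≤ 4`, so the weight is largest at the
        -- outer edge of the annulus.
        exact Real.rpow_le_rpow (by positivity) hxs.2 (by linarith)
      · have hxs : ‖x‖ ^ 2 ∉ Set.Icc R (2 * R) := hxA
        rw [Set.indicator_of_notMem hxs] at hx
        have : deriv (deriv ζ) (‖x‖ ^ 2) = f (‖x‖ ^ 2) :=
          sub_eq_zero.1 (abs_eq_zero.1 (le_antisymm hx (abs_nonneg _)))
        simp [this]
    calc ENNReal.ofReal I
        ≤ ENNReal.ofReal (I - ∫ x, u x * ((‖x‖ ^ 2) ^ (1 - (N : ℝ) / 4)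
            * deriv (deriv ζ) (‖x‖ ^ 2))) := ENNReal.ofReal_le_ofReal (by linarith)
      _ = ENNReal.ofReal (∫ x, (u x * ((‖x‖ ^ 2) ^ (1 - (N : ℝ) / 4) * f (‖x‖ ^ 2))
            - u x * ((‖x‖ ^ 2) ^ (1 - (N : ℝ) / 4) * deriv (deriv ζ) (‖x‖ ^ 2)))) := by
          rw [integral_sub hfi hζi]
      _ ≤ ‖∫ x, (u x * ((‖x‖ ^ 2) ^ (1 - (N : ℝ) / 4) * f (‖x‖ ^ 2))
            - u x * ((‖x‖ ^ 2) ^ (1 - (N : ℝ) / 4) * deriv (deriv ζ) (‖x‖ ^ 2)))‖ₑ := by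
          rw [Real.enorm_eq_ofReal_abs]
          exact ENNReal.ofReal_le_ofReal (le_abs_self _)
      _ ≤ ∫⁻ x, ‖u x * ((‖x‖ ^ 2) ^ (1 - (N : ℝ) / 4) * f (‖x‖ ^ 2))
            - u x * ((‖x‖ ^ 2) ^ (1 - (N : ℝ) / 4) * deriv (deriv ζ) (‖x‖ ^ 2))‖ₑ :=
          enorm_integral_le_lintegral_enorm _
      _ ≤ ∫⁻ x, A.indicator (fun x => ENNReal.ofReal K * ‖u x‖ₑ) x := lintegral_mono hpt
      _ = ENNReal.ofReal K * ∫⁻ x in A, ‖u x‖ₑ := by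
          rw [lintegral_indicator hAm, lintegral_const_mul' _ _ ENNReal.ofReal_ne_top]
      _ ≤ ENNReal.ofReal K * (eLpNorm ((Metric.ball (0 : Eu N) n)ᶜ.indicator u) 2 volume
            * (ENNReal.ofReal ((2 * R) ^ ((N : ℝ) / 4)) * κ)) := by
          gcongr
          exact lintegral_annulus_le hu hn hR
      _ = (ENNReal.ofReal K * ENNReal.ofReal ((2 * R) ^ ((N : ℝ) / 4)) * κ)
            * eLpNorm ((Metric.ball (0 : Eu N) n)ᶜ.indicator u) 2 volume := by ring
      _ = _ := by
          rw [← ENNReal.ofReal_mul (by positivity)]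
          congr 3
          -- The critical cancellation: the weight and the square root of the volume multiply to
          -- `2R`, exactly offset by the error size `C/R`. The constant `2C` is therefore
          -- independent of `R`.
          have : (2 * R) ^ (1 - (N : ℝ) / 4) * (2 * R) ^ ((N : ℝ) / 4) = 2 * R := by
            rw [← Real.rpow_add (by positivity)]
            simp
          rw [hK, mul_right_comm, this]
          field_simp
  have hlim : Tendsto (fun n : ℕ => (ENNReal.ofReal (2 * C) * κ)
      * eLpNorm ((Metric.ball (0 : Eu N) n)ᶜ.indicator u) 2 volume) atTop (𝓝 0) := by
    have := ENNReal.Tendsto.const_mul (a := ENNReal.ofReal (2 * C) * κ)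
      (tendsto_eLpNorm_indicator_compl_ball hu)
      (Or.inr (ENNReal.mul_ne_top ENNReal.ofReal_ne_top hκt))
    simpa using this
  exact ENNReal.ofReal_eq_zero.1 (le_antisymm (ge_of_tendsto hlim hbound) bot_le)

/-- A square-integrable nonnegative supersolution outside a ball vanishes there. -/
theorem ae_eq_zero_of_supersolution {N : ℕ} (hN : N ≤ 4) {ρ : ℝ} (hρ : 0 ≤ ρ) {V u : Eu N → ℝ}
    (hV : MemLinftyLoc (Metric.ball 0 ρ)ᶜ V)
    (hVle : ∀ᵐ x : Eu N, ρ ≤ ‖x‖ → V x ≤ (N : ℝ) * (4 - (N : ℝ)) / 4 * (‖x‖ ^ 2)⁻¹)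
    (hu : MemLp u 2) (hu0 : ∀ᵐ x : Eu N, ρ ≤ ‖x‖ → 0 ≤ u x)
    (hAu : IsWeakSupersolution (Metric.closedBall 0 ρ)ᶜ V u) :
    ∀ᵐ x : Eu N, ρ < ‖x‖ → u x = 0 := by
  -- Rational centres make the family of exceptional null sets countable. The radius is half the
  -- distance from `c` to `ρ²`, so the bump stays strictly inside `(ρ²,∞)`.
  have hloc : ∀ c : ℚ, ∀ᵐ x : Eu N, ρ ^ 2 < c → |‖x‖ ^ 2 - (c : ℝ)| < (c - ρ ^ 2) / 2 → u x = 0 := by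
    intro c
    by_cases hc : ρ ^ 2 < (c : ℝ)
    swap
    · exact ae_of_all _ fun x h => absurd h hc
    let B : ContDiffBump (c : ℝ) := ⟨(c - ρ ^ 2) / 4, (c - ρ ^ 2) / 2, by linarith, by linarith⟩
    have hB0 : ∀ s : ℝ, (c - ρ ^ 2) / 2 ≤ |s - (c : ℝ)| → B s = 0 := fun s hs =>
      B.zero_of_le_dist (by simpa [B, Real.dist_eq] using hs)
    have hBpos : ∀ s : ℝ, |s - (c : ℝ)| < (c - ρ ^ 2) / 2 → 0 < B s := fun s hs =>
      B.pos_of_mem_ball (by simpa [B, Real.dist_eq] using hs)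
    obtain ⟨hi, hle⟩ := integral_mul_bump_nonpos hN hV hVle hu hu0 hAu (f := B) B.contDiff
      (fun s => B.nonneg) (a := c - (c - ρ ^ 2) / 2) (b := c + (c - ρ ^ 2) / 2) (by linarith)
      (fun s hs => hB0 s (by rw [abs_sub_comm]; exact le_trans (le_sub_comm.1 hs) (le_abs_self _)))
      (fun s hs => hB0 s (le_trans (le_sub_iff_add_le'.2 hs) (le_abs_self _)))
    have hnn : 0 ≤ᵐ[volume] fun x : Eu N =>
        u x * ((‖x‖ ^ 2) ^ (1 - (N : ℝ) / 4) * B (‖x‖ ^ 2)) := by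
      filter_upwards [hu0] with x hx
      by_cases h : B (‖x‖ ^ 2) = 0
      · simp [h]
      · have h1 : |‖x‖ ^ 2 - (c : ℝ)| < (c - ρ ^ 2) / 2 := by
          by_contra h2
          exact h (hB0 _ (not_lt.1 h2))
        have h3 : ρ ^ 2 ≤ ‖x‖ ^ 2 := by linarith [(abs_lt.1 h1).1]
        have h4 : ρ ≤ ‖x‖ := le_of_sq_le_sq h3 (norm_nonneg _)
        have := B.nonneg (x := ‖x‖ ^ 2)
        have := hx h4
        positivity
    have hz := (integral_eq_zero_iff_of_nonneg_ae hnn hi).1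
      (le_antisymm hle (integral_nonneg_of_ae hnn))
    filter_upwards [hz] with x hx _ h1
    have h3 : 0 < ‖x‖ ^ 2 := by nlinarith [(abs_lt.1 h1).1, sq_nonneg ρ]
    have h4 : 0 < (‖x‖ ^ 2) ^ (1 - (N : ℝ) / 4) * B (‖x‖ ^ 2) :=
      mul_pos (Real.rpow_pos_of_pos h3 _) (hBpos _ h1)
    exact (mul_eq_zero.1 hx).resolve_right h4.ne'
  filter_upwards [ae_all_iff.2 hloc] with x hx hxρ
  have h1 : ρ ^ 2 < ‖x‖ ^ 2 := pow_lt_pow_left₀ hxρ hρ two_ne_zero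
  -- A centre just above `|x|²` suffices: `c - |x|² < (|x|² - ρ²)/2 < (c - ρ²)/2`.
  obtain ⟨c, hc1, hc2⟩ := exists_rat_btwn
    (show ‖x‖ ^ 2 < ‖x‖ ^ 2 + (‖x‖ ^ 2 - ρ ^ 2) / 2 by linarith)
  refine hx c (h1.trans hc1) ?_
  rw [abs_lt]
  constructor <;> linarith

/-! ### Polar coordinates and the exterior trace inequality. -/

/-- Integration in polar coordinates. -/
theorem lintegral_eq_lintegral_sphere {N : ℕ} (hN : 0 < N) {F : Eu N → ENNReal}
    (hF : Measurable F) :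
    ∫⁻ x, F x = ∫⁻ θ : Metric.sphere (0 : Eu N) 1,
      (∫⁻ r in Set.Ioi (0 : ℝ), ENNReal.ofReal (r ^ (N - 1)) * F (r • (θ : Eu N)))
        ∂(volume : Measure (Eu N)).toSphere := by
  have : Nontrivial (Eu N) := by
    have : Nonempty (Fin N) := ⟨⟨0, hN⟩⟩
    infer_instance
  have hmp := (volume : Measure (Eu N)).measurePreserving_homeomorphUnitSphereProd
  have hfin : Module.finrank ℝ (Eu N) = N := by simp
  have hsm : Measurable (fun p : Metric.sphere (0 : Eu N) 1 × Set.Ioi (0 : ℝ) =>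
      F ((p.2 : ℝ) • (p.1 : Eu N))) := by
    apply hF.comp
    exact (measurable_subtype_coe.comp measurable_snd).smul
      (measurable_subtype_coe.comp measurable_fst)
  calc ∫⁻ x, F x = ∫⁻ x in ({0}ᶜ : Set (Eu N)), F x := by rw [restrict_compl_singleton]
    _ = ∫⁻ x : ({0}ᶜ : Set (Eu N)), F x ∂(Measure.comap Subtype.val volume) :=
        (lintegral_subtype_comap (measurableSet_singleton _).compl F).symm
    _ = ∫⁻ x : ({0}ᶜ : Set (Eu N)),
          (fun p : Metric.sphere (0 : Eu N) 1 × Set.Ioi (0 : ℝ) => F ((p.2 : ℝ) • (p.1 : Eu N)))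
            (homeomorphUnitSphereProd (Eu N) x) ∂(Measure.comap Subtype.val volume) := by
        congr 1 with x
        have := homeomorphUnitSphereProd_symm_apply_coe (Eu N) (homeomorphUnitSphereProd (Eu N) x)
        rw [Homeomorph.symm_apply_apply] at this
        rw [this]
    _ = ∫⁻ p, F ((p.2 : ℝ) • (p.1 : Eu N)) ∂((volume : Measure (Eu N)).toSphere.prod
          (Measure.volumeIoiPow (Module.finrank ℝ (Eu N) - 1))) :=
        hmp.lintegral_comp_emb (Homeomorph.measurableEmbedding _)
          (fun p => F ((p.2 : ℝ) • (p.1 : Eu N)))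
    _ = ∫⁻ θ : Metric.sphere (0 : Eu N) 1, (∫⁻ r : Set.Ioi (0 : ℝ), F ((r : ℝ) • (θ : Eu N))
          ∂(Measure.volumeIoiPow (Module.finrank ℝ (Eu N) - 1)))
            ∂(volume : Measure (Eu N)).toSphere := lintegral_prod _ hsm.aemeasurable
    _ = _ := by
        congr 1 with θ
        rw [hfin, Measure.volumeIoiPow, lintegral_withDensity_eq_lintegral_mul]
        · exact lintegral_subtype_comap measurableSet_Ioi
            (fun r => ENNReal.ofReal (r ^ (N - 1)) * F (r • (θ : Eu N)))
        · exact (measurable_subtype_coe.pow_const _).ennreal_ofReal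
        · exact hF.comp (measurable_subtype_coe.smul_const _)

theorem lintegral_sphereMeasure {N : ℕ} (M : ℝ) {F : Eu N → ENNReal} (hF : Measurable F) :
    ∫⁻ x, F x ∂sphereMeasure N M = ENNReal.ofReal (M ^ (N - 1)) *
      ∫⁻ θ : Metric.sphere (0 : Eu N) 1, F (M • (θ : Eu N)) ∂(volume : Measure (Eu N)).toSphere := by
  rw [sphereMeasure, lintegral_smul_measure, lintegral_map hF, smul_eq_mul]
  exact Measurable.const_smul (measurable_subtype_coe (p := (· ∈ Metric.sphere (0 : Eu N) 1))) M

/-- The fundamental theorem of calculus along a ray. -/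
theorem enorm_sq_le_lintegral_ray {N : ℕ} {φ : Eu N → ℝ} (hφ : ContDiff ℝ 1 φ)
    (hc : HasCompactSupport φ) {θ : Eu N} (hθ : ‖θ‖ = 1) (M : ℝ) :
    ‖φ (M • θ)‖ₑ ^ 2
      ≤ ∫⁻ r in Set.Ioi M, 2 * (‖φ (r • θ)‖ₑ * ‖gradient φ (r • θ)‖ₑ) := by
  have hray : ∀ r : ℝ, HasDerivAt (fun r : ℝ => r • θ) θ r := fun r => by
    simpa using (hasDerivAt_id r).smul_const θ
  have hd : ∀ r : ℝ, HasDerivAt (fun r => φ (r • θ)) (inner ℝ (gradient φ (r • θ)) θ) r := fun r => by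
    rw [inner_gradient_left]
    exact ((hφ.differentiable one_ne_zero) _).hasFDerivAt.comp_hasDerivAt r (hray r)
  have hd2 : ∀ r : ℝ, HasDerivAt (fun r => φ (r • θ) ^ 2)
      (2 * φ (r • θ) * inner ℝ (gradient φ (r • θ)) θ) r := fun r => by
    have := (hd r).fun_pow 2
    simpa using this
  have hcd : ContDiff ℝ 1 (fun r : ℝ => φ (r • θ) ^ 2) :=
    (hφ.comp (contDiff_id.smul contDiff_const)).pow 2
  -- Compact support along the ray removes the boundary term at infinity in the fundamental theorem
  -- of calculus.
  have hcs : HasCompactSupport (fun r : ℝ => φ (r • θ) ^ 2) := by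
    obtain ⟨B, hB⟩ := hc.isBounded.exists_norm_le
    refine HasCompactSupport.of_support_subset_isCompact (isCompact_Icc (a := -B) (b := B)) ?_
    intro r hr
    have h1 : r • θ ∈ tsupport φ := subset_tsupport _ fun h0 => hr (by simp [h0])
    have h2 := hB _ h1
    rw [norm_smul, hθ, mul_one, Real.norm_eq_abs] at h2
    exact abs_le.1 h2
  have hftc := hcs.integral_Ioi_deriv_eq hcd M
  have e1 : deriv (fun r : ℝ => φ (r • θ) ^ 2)
      = fun r => 2 * φ (r • θ) * inner ℝ (gradient φ (r • θ)) θ := funext fun r => (hd2 r).deriv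
  rw [e1] at hftc
  calc ‖φ (M • θ)‖ₑ ^ 2 = ‖-φ (M • θ) ^ 2‖ₑ := by rw [enorm_neg, enorm_pow]
    _ ≤ ∫⁻ r in Set.Ioi M, ‖2 * φ (r • θ) * inner ℝ (gradient φ (r • θ)) θ‖ₑ := by
        rw [← hftc]
        exact enorm_integral_le_lintegral_enorm _
    _ ≤ _ := by
        refine lintegral_mono fun r => ?_
        have h2 : ‖(2 : ℝ)‖ₑ = 2 := by simp [Real.enorm_eq_ofReal_abs]
        rw [enorm_mul, enorm_mul, h2, mul_assoc]
        gcongr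
        have := norm_inner_le_norm (𝕜 := ℝ) (gradient φ (r • θ)) θ
        rw [hθ, mul_one] at this
        exact enorm_le_iff_norm_le.2 this

theorem continuous_gradient {N : ℕ} {φ : Eu N → ℝ} (hφ : ContDiff ℝ 1 φ) :
    Continuous (gradient φ) :=
  (InnerProductSpace.toDual ℝ (Eu N)).symm.continuous.comp (hφ.continuous_fderiv one_ne_zero)

/-- The exterior trace inequality. -/
theorem lintegral_sphereMeasure_sq_le {N : ℕ} (hN : 0 < N) {M : ℝ} (hM : 0 ≤ M) {φ : Eu N → ℝ}
    (hφ : ContDiff ℝ 1 φ) (hc : HasCompactSupport φ) :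
    ∫⁻ x, ‖φ x‖ₑ ^ 2 ∂sphereMeasure N M
      ≤ 2 * ∫⁻ x in {x : Eu N | M < ‖x‖}, ‖φ x‖ₑ * ‖gradient φ x‖ₑ := by
  have hset : MeasurableSet {x : Eu N | M < ‖x‖} := measurableSet_lt measurable_const measurable_norm
  have hm1 : Measurable (fun x : Eu N => ‖φ x‖ₑ ^ 2) := (hφ.continuous.measurable.enorm).pow_const _
  have hm2 : Measurable (fun x : Eu N => ‖φ x‖ₑ * ‖gradient φ x‖ₑ) :=
    hφ.continuous.measurable.enorm.mul (continuous_gradient hφ).measurable.enorm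
  rw [lintegral_sphereMeasure M hm1, ← lintegral_const_mul _ hm2, ← lintegral_indicator hset,
    lintegral_eq_lintegral_sphere hN ((hm2.const_mul 2).indicator hset),
    ← lintegral_const_mul' _ _ ENNReal.ofReal_ne_top]
  refine lintegral_mono fun θ => ?_
  have hθ : ‖(θ : Eu N)‖ = 1 := by simp
  have h1 : ENNReal.ofReal (M ^ (N - 1)) * ‖φ (M • (θ : Eu N))‖ₑ ^ 2 ≤ ENNReal.ofReal (M ^ (N - 1)) *
      ∫⁻ r in Set.Ioi M, 2 * (‖φ (r • (θ : Eu N))‖ₑ * ‖gradient φ (r • (θ : Eu N))‖ₑ) := by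
    gcongr
    exact enorm_sq_le_lintegral_ray hφ hc hθ M
  refine h1.trans ?_
  rw [← lintegral_const_mul' _ _ ENNReal.ofReal_ne_top]
  -- For `r > M ≥ 0` one has `M^(N-1) ≤ r^(N-1)`, so the surface factor is absorbed by the polar
  -- Jacobian. This is why the rays run outwards.
  refine le_trans (setLIntegral_mono' measurableSet_Ioi fun r hr => ?_)
    (lintegral_mono_set (Set.Ioi_subset_Ioi hM))
  have hr' : M < r := hr
  have hmem : r • (θ : Eu N) ∈ {x : Eu N | M < ‖x‖} := by
    have : ‖r • (θ : Eu N)‖ = r := by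
      rw [norm_smul, hθ, mul_one, Real.norm_of_nonneg (hM.trans hr'.le)]
    simpa [this] using hr'
  rw [Set.indicator_of_mem hmem]
  gcongr

theorem eLpNorm_two_sq {α F : Type*} [MeasurableSpace α] [NormedAddCommGroup F] (f : α → F)
    (μ : Measure α) : eLpNorm f 2 μ ^ 2 = ∫⁻ x, ‖f x‖ₑ ^ 2 ∂μ := by
  have := eLpNorm_nnreal_pow_eq_lintegral (f := f) (μ := μ) (p := 2) two_ne_zero
  simpa using this

/-- Cauchy–Schwarz applied to the exterior trace inequality. The function is measured only outside
the sphere, which is what makes the trace vanish when the limit function does; the product form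
needs only boundedness of the gradients. -/
theorem eLpNorm_sphereMeasure_sq_le {N : ℕ} (hN : 0 < N) {M : ℝ} (hM : 0 ≤ M) {φ : Eu N → ℝ}
    (hφ : ContDiff ℝ 1 φ) (hc : HasCompactSupport φ) :
    eLpNorm φ 2 (sphereMeasure N M) ^ 2
      ≤ 2 * (eLpNorm φ 2 (volume.restrict {x : Eu N | M < ‖x‖}) * eLpNorm (gradient φ) 2 volume) := by
  rw [eLpNorm_two_sq]
  refine (lintegral_sphereMeasure_sq_le hN hM hφ hc).trans ?_
  gcongr
  have h := ENNReal.lintegral_mul_le_Lp_mul_Lq (volume.restrict {x : Eu N | M < ‖x‖})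
    Real.HolderConjugate.two_two (f := fun x => ‖φ x‖ₑ) (g := fun x => ‖gradient φ x‖ₑ)
    hφ.continuous.measurable.enorm.aemeasurable
    (continuous_gradient hφ).measurable.enorm.aemeasurable
  simp only [Pi.mul_apply] at h
  refine h.trans ?_
  have e : ∀ {F : Type} [NormedAddCommGroup F] (f : Eu N → F) (μ : Measure (Eu N)),
      (∫⁻ x, ‖f x‖ₑ ^ (2 : ℝ) ∂μ) ^ (1 / (2 : ℝ)) = eLpNorm f 2 μ := fun f μ => by
    rw [eLpNorm_eq_lintegral_rpow_enorm_toReal (by simp) (by simp)]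
    simp
  rw [e, e]
  gcongr
  exact Measure.restrict_le_self

/-! ### Mollification and density of `C_c^∞` in `H^1`. -/

/-- The convolution of a vector-valued function `f` with a kernel `ψ`. -/
noncomputable def mollify {N : ℕ} {F : Type*} [NormedAddCommGroup F] [NormedSpace ℝ F]
    (ψ : Eu N → ℝ) (f : Eu N → F) : Eu N → F :=
  convolution f ψ (ContinuousLinearMap.lsmul ℝ ℝ).flip volume

theorem mollify_apply {N : ℕ} {F : Type*} [NormedAddCommGroup F] [NormedSpace ℝ F]
    (ψ : Eu N → ℝ) (f : Eu N → F) (x : Eu N) : mollify ψ f x = ∫ y, ψ (x - y) • f y := rfl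

theorem mollify_apply_swap {N : ℕ} {F : Type*} [NormedAddCommGroup F] [NormedSpace ℝ F]
    (ψ : Eu N → ℝ) (f : Eu N → F) (x : Eu N) : mollify ψ f x = ∫ t, ψ t • f (x - t) := by
  rw [mollify_apply, ← integral_sub_left_eq_self _ volume x]
  simp

theorem integrable_mollify_swap {N : ℕ} {F : Type*} [NormedAddCommGroup F] [NormedSpace ℝ F]
    {ψ : Eu N → ℝ} (hψ : Continuous ψ) (hc : HasCompactSupport ψ) {f : Eu N → F}
    (hf : LocallyIntegrable f) (x : Eu N) : Integrable (fun t => ψ t • f (x - t)) := by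
  have h := hc.convolutionExists_right (ContinuousLinearMap.lsmul ℝ ℝ).flip hf hψ x
  have h2 : Integrable (fun y => ψ (x - y) • f y) := h
  simpa using h2.comp_sub_left x

/-- Translations are continuous in `L^2`. -/
theorem exists_eLpNorm_translate_sub_le {N : ℕ} {F : Type*} [NormedAddCommGroup F]
    {f : Eu N → F} (hf : MemLp f 2) {ε : ENNReal} (hε : 0 < ε) :
    ∃ δ > 0, ∀ t : Eu N, ‖t‖ < δ → eLpNorm (fun x => f (x - t) - f x) 2 volume ≤ ε := by
  let g : C(Eu N, C(Eu N, Eu N)) := ContinuousMap.curry ⟨fun p => p.2 - p.1, by fun_prop⟩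
  have hg : ∀ t x, g t x = x - t := fun t x => rfl
  have hgm : ∀ t, MeasurePreserving (g t) (volume : Measure (Eu N)) volume := fun t =>
    measurePreserving_sub_right volume t
  have hcont := (continuousAt_const (x := (0 : Eu N)) (y := hf.toLp f)).compMeasurePreservingLp
    g.continuous.continuousAt hgm (by simp)
  rw [ContinuousAt, EMetric.tendsto_nhds] at hcont
  obtain ⟨δ, hδ, h⟩ := Metric.eventually_nhds_iff.1 (hcont ε hε)
  refine ⟨δ, hδ, fun t ht => ?_⟩
  have h1 := (h (by simpa using ht)).le
  rw [Lp.toLp_compMeasurePreserving, Lp.toLp_compMeasurePreserving, Lp.edist_toLp_toLp] at h1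
  convert! h1 using 2
  ext1 x
  simp [hg]

/-- Jensen's inequality for the square, obtained from Cauchy–Schwarz with `w h = w^(1/2) · (w^(1/2)
h)`. -/
theorem lintegral_mul_sq_le {α : Type*} [MeasurableSpace α] {μ : Measure α} {w h : α → ENNReal}
    (hw : Measurable w) (hh : AEMeasurable h μ) (hw1 : ∫⁻ t, w t ∂μ ≤ 1) :
    (∫⁻ t, w t * h t ∂μ) ^ 2 ≤ ∫⁻ t, w t * h t ^ 2 ∂μ := by
  have hH := ENNReal.lintegral_mul_le_Lp_mul_Lq μ Real.HolderConjugate.two_two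
    (f := fun t => w t ^ ((1 : ℝ) / 2)) (g := fun t => w t ^ ((1 : ℝ) / 2) * h t)
    (hw.pow_const _).aemeasurable ((hw.pow_const _).aemeasurable.mul hh)
  have hr : ∀ z : ENNReal, z ^ ((1 : ℝ) / 2) * z ^ ((1 : ℝ) / 2) = z := fun z => by
    rw [← ENNReal.rpow_add_of_nonneg _ _ (by norm_num) (by norm_num)]; norm_num
  have hs : ∀ z : ENNReal, (z ^ ((1 : ℝ) / 2)) ^ (2 : ℝ) = z := fun z => by
    rw [← ENNReal.rpow_mul]; norm_num
  simp only [Pi.mul_apply, ← mul_assoc, hr, hs,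
    ENNReal.mul_rpow_of_nonneg _ _ (by norm_num : (0 : ℝ) ≤ 2)] at hH
  have h1 : (∫⁻ t, w t ∂μ) ^ ((1 : ℝ) / 2) ≤ 1 := ENNReal.rpow_le_one hw1 (by norm_num)
  have h2 := hH.trans (mul_le_mul_left h1 _)
  rw [one_mul] at h2
  calc (∫⁻ t, w t * h t ∂μ) ^ 2 ≤ ((∫⁻ t, w t * h t ^ (2 : ℝ) ∂μ) ^ ((1 : ℝ) / 2)) ^ 2 := by gcongr
    _ = ∫⁻ t, w t * h t ^ 2 ∂μ := by
        rw [sq, hr]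
        simp

/-- `mollify ψ f - f` is an average of the differences `f(· - t) - f` over `|t| < δ`, so Jensen and
Tonelli bound its norm by the largest of theirs. Strong measurability makes the difference jointly
measurable in `(x,t)`, as Tonelli requires; the next lemma passes to a representative. -/
theorem eLpNorm_mollify_sub_le_of_stronglyMeasurable {N : ℕ} {F : Type*} [NormedAddCommGroup F]
    [NormedSpace ℝ F] [CompleteSpace F] {f : Eu N → F} (hfm : StronglyMeasurable f)
    (hf : MemLp f 2) {ε : ENNReal} {δ : ℝ}
    (hδ : ∀ t : Eu N, ‖t‖ < δ → eLpNorm (fun x => f (x - t) - f x) 2 volume ≤ ε)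
    (B : ContDiffBump (0 : Eu N)) (hB : B.rOut ≤ δ) :
    eLpNorm (mollify (B.normed volume) f - f) 2 volume ≤ ε := by
  set ψ := B.normed (volume : Measure (Eu N)) with hψ
  have hψc : Continuous ψ := B.continuous_normed
  have hψ1 : ∫⁻ t, ‖ψ t‖ₑ = 1 := by
    have h1 : ∀ t, ‖ψ t‖ₑ = ENNReal.ofReal (ψ t) := fun t => Real.enorm_of_nonneg (B.nonneg_normed t)
    simp only [h1]
    rw [← ofReal_integral_eq_lintegral_ofReal B.integrable_normed
      (ae_of_all _ fun t => B.nonneg_normed t), B.integral_normed, ENNReal.ofReal_one]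
  have hloc : LocallyIntegrable f := hf.locallyIntegrable (by norm_num)
  have hjm : StronglyMeasurable (fun p : Eu N × Eu N => f (p.1 - p.2) - f p.1) :=
    (hfm.comp_measurable (measurable_fst.sub measurable_snd)).sub (hfm.comp_measurable measurable_fst)
  have hpt : ∀ x, ‖(mollify ψ f - f) x‖ₑ ^ 2 ≤ ∫⁻ t, ‖ψ t‖ₑ * ‖f (x - t) - f x‖ₑ ^ 2 := by
    intro x
    have e1 : (mollify ψ f - f) x = ∫ t, ψ t • (f (x - t) - f x) := by
      simp only [smul_sub]
      rw [integral_sub (integrable_mollify_swap hψc B.hasCompactSupport_normed hloc x)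
        (B.integrable_normed.smul_const _), integral_smul_const, B.integral_normed, one_smul,
        ← mollify_apply_swap, Pi.sub_apply]
    have hm : AEMeasurable (fun t => ‖f (x - t) - f x‖ₑ) :=
      (hjm.comp_measurable (measurable_prodMk_left (x := x))).enorm.aemeasurable
    refine le_trans ?_ (lintegral_mul_sq_le hψc.measurable.enorm hm hψ1.le)
    gcongr
    rw [e1]
    refine (enorm_integral_le_lintegral_enorm _).trans (le_of_eq ?_)
    simp only [enorm_smul]
  have hsq : eLpNorm (mollify ψ f - f) 2 volume ^ 2 ≤ ε ^ 2 := by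
    rw [eLpNorm_two_sq]
    calc ∫⁻ x, ‖(mollify ψ f - f) x‖ₑ ^ 2
        ≤ ∫⁻ x, ∫⁻ t, ‖ψ t‖ₑ * ‖f (x - t) - f x‖ₑ ^ 2 := lintegral_mono hpt
      _ = ∫⁻ t, ∫⁻ x, ‖ψ t‖ₑ * ‖f (x - t) - f x‖ₑ ^ 2 := by
          refine lintegral_lintegral_swap (Measurable.aemeasurable ?_)
          exact (hψc.measurable.enorm.comp measurable_snd).mul (hjm.enorm.pow_const 2)
      _ = ∫⁻ t, ‖ψ t‖ₑ * eLpNorm (fun x => f (x - t) - f x) 2 volume ^ 2 := by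
          congr 1 with t
          rw [lintegral_const_mul' _ _ enorm_ne_top, eLpNorm_two_sq]
      _ ≤ ∫⁻ t, ‖ψ t‖ₑ * ε ^ 2 := by
          refine lintegral_mono fun t => ?_
          by_cases ht : ψ t = 0
          · simp [ht]
          · have h1 : t ∈ Function.support ψ := ht
            rw [hψ, B.support_normed_eq, mem_ball_zero_iff] at h1
            have := hδ t (h1.trans_le hB)
            gcongr
      _ = ε ^ 2 := by
          rw [lintegral_mul_const _ hψc.measurable.enorm, hψ1, one_mul]
  exact (ENNReal.pow_le_pow_left_iff two_ne_zero).1 hsq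

theorem exists_eLpNorm_mollify_sub_le {N : ℕ} {F : Type*} [NormedAddCommGroup F]
    [NormedSpace ℝ F] [CompleteSpace F] {f : Eu N → F} (hf : MemLp f 2) {ε : ENNReal} (hε : 0 < ε) :
    ∃ δ > 0, ∀ B : ContDiffBump (0 : Eu N), B.rOut ≤ δ →
      eLpNorm (mollify (B.normed volume) f - f) 2 volume ≤ ε := by
  set f' := hf.1.mk f with hf'
  have hae : f =ᵐ[volume] f' := hf.1.ae_eq_mk
  have hfl : MemLp f' 2 := hf.ae_eq hae
  obtain ⟨δ, hδ, h⟩ := exists_eLpNorm_translate_sub_le hfl hε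
  refine ⟨δ, hδ, fun B hB => ?_⟩
  have h1 := eLpNorm_mollify_sub_le_of_stronglyMeasurable hf.1.stronglyMeasurable_mk hfl h B hB
  have h2 : mollify (B.normed volume) f = mollify (B.normed volume) f' :=
    convolution_congr _ hae (ae_eq_refl _)
  rw [h2]
  refine le_trans (le_of_eq (eLpNorm_congr_ae ?_)) h1
  filter_upwards [hae] with x hx
  rw [Pi.sub_apply, Pi.sub_apply, hx]

theorem gradient_sub_left {N : ℕ} {ψ : Eu N → ℝ} (hψ : Differentiable ℝ ψ) (x y : Eu N) :
    gradient (fun y => ψ (x - y)) y = -gradient ψ (x - y) := by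
  refine HasGradientAt.gradient ?_
  rw [hasGradientAt_iff_hasFDerivAt]
  have h := (hψ (x - y)).hasGradientAt.hasFDerivAt.comp y ((hasFDerivAt_id y).const_sub x)
  convert! h using 1
  ext v
  simp

/-- Mollification commutes with the weak gradient. -/
theorem HasWeakGradient.gradient_mollify {N : ℕ} {u : Eu N → ℝ} {g : Eu N → Eu N}
    (hg : HasWeakGradient Set.univ u g) {ψ : Eu N → ℝ} (hψ : ContDiff ℝ ∞ ψ)
    (hc : HasCompactSupport ψ) (x : Eu N) :
    gradient (mollify ψ u) x = mollify ψ g x := by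
  have hu : LocallyIntegrable u := locallyIntegrableOn_univ.1 hg.locallyIntegrableOn
  have hψ1 : ContDiff ℝ 1 ψ := hψ.of_le (by exact_mod_cast le_top)
  have hd : Differentiable ℝ ψ := hψ.differentiable (by simp)
  -- The reflected translate of the kernel is the test function; the sign from differentiating in
  -- `y` cancels the sign in the weak gradient identity.
  have htest : IsTestFunction Set.univ (fun y => ψ (x - y)) :=
    ⟨hψ.comp (contDiff_const.sub contDiff_id),
      hc.comp_homeomorph (Homeomorph.subLeft x), Set.subset_univ _⟩
  have hweak := hg.integral_eq _ htest
  simp only [gradient_sub_left hd, smul_neg, integral_neg, neg_inj] at hweak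
  have hfd := hc.hasFDerivAt_convolution_right (ContinuousLinearMap.lsmul ℝ ℝ).flip hu hψ1 x
  have hgc : Continuous (gradient ψ) := continuous_gradient hψ1
  have hgs : HasCompactSupport (gradient ψ) := by
    refine hc.mono' ((fun y hy => ?_ : Function.support (gradient ψ) ⊆ tsupport ψ))
    exact support_fderiv_subset ℝ fun h0 => hy (by simp [gradient, h0])
  have hint : Integrable (fun y => u y • gradient ψ (x - y)) := by
    have hcx : Continuous fun y => gradient ψ (x - y) := hgc.comp (by fun_prop)
    exact hu.integrable_smul_right_of_hasCompactSupport hcx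
      (hgs.comp_homeomorph (Homeomorph.subLeft x))
  refine HasGradientAt.gradient ?_
  rw [hasGradientAt_iff_hasFDerivAt]
  convert! hfd using 1
  ext v
  rw [convolution_precompR_apply _ hu (hc.fderiv ℝ) (hψ1.continuous_fderiv one_ne_zero)]
  rw [InnerProductSpace.toDual_apply_apply, mollify_apply, ← hweak, real_inner_comm,
    ← integral_inner hint]
  rw [convolution]
  congr 1 with y
  rw [real_inner_smul_right, real_inner_comm, inner_gradient_left]
  simp [mul_comm]

theorem contDiff_mollify {N : ℕ} {u : Eu N → ℝ} (hu : LocallyIntegrable u) {ψ : Eu N → ℝ}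
    (hψ : ContDiff ℝ ∞ ψ) (hc : HasCompactSupport ψ) : ContDiff ℝ ∞ (mollify ψ u) :=
  hc.contDiff_convolution_right _ hu hψ

/-- Smooth cutoffs `χ_n = 1` on the ball of radius `n`, with gradients of size `O(1/n)`. -/
theorem exists_cutoff_sequence (N : ℕ) : ∃ C : ℝ, 0 ≤ C ∧ ∃ χ : ℕ → Eu N → ℝ, ∀ n : ℕ, 0 < n →
    IsTestFunction Set.univ (χ n) ∧ (∀ x, 0 ≤ χ n x ∧ χ n x ≤ 1) ∧
    (∀ x ∈ Metric.ball (0 : Eu N) n, χ n x = 1) ∧ ∀ x, ‖gradient (χ n) x‖ ≤ C * (n : ℝ)⁻¹ := by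
  let B : ContDiffBump (0 : Eu N) := ⟨1, 2, by norm_num, by norm_num⟩
  have hB : ContDiff ℝ ∞ B := B.contDiff
  obtain ⟨C, hC⟩ := (B.hasCompactSupport.fderiv ℝ).exists_bound_of_continuous
    (hB.continuous_fderiv (by simp))
  refine ⟨C, (norm_nonneg _).trans (hC 0), fun n x => B ((n : ℝ)⁻¹ • x), fun n hn => ?_⟩
  have hn0 : (n : ℝ)⁻¹ ≠ 0 := by positivity
  refine ⟨⟨hB.comp (contDiff_const_smul _), B.hasCompactSupport.comp_smul hn0, Set.subset_univ _⟩,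
    fun x => ⟨B.nonneg, B.le_one⟩, fun x hx => ?_, fun x => ?_⟩
  · refine B.one_of_mem_closedBall ?_
    rw [mem_ball_zero_iff] at hx
    rw [mem_closedBall_zero_iff, norm_smul, norm_inv, Real.norm_natCast]
    change (n : ℝ)⁻¹ * ‖x‖ ≤ 1
    rw [inv_mul_le_iff₀ (by positivity)]
    linarith
  · have h1 : ‖gradient (fun x => B ((n : ℝ)⁻¹ • x)) x‖
        = ‖fderiv ℝ (fun x => B ((n : ℝ)⁻¹ • x)) x‖ := by
      simp [gradient]
    rw [h1, fderiv_comp_smul, norm_smul, norm_inv, Real.norm_natCast, mul_comm]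
    gcongr
    exact hC _

theorem gradient_mul {N : ℕ} {a b : Eu N → ℝ} (ha : Differentiable ℝ a) (hb : Differentiable ℝ b)
    (x : Eu N) : gradient (fun x => a x * b x) x = a x • gradient b x + b x • gradient a x := by
  refine HasGradientAt.gradient ?_
  rw [hasGradientAt_iff_hasFDerivAt]
  have h := (ha x).hasFDerivAt.mul (hb x).hasFDerivAt
  convert! h using 1
  ext v
  simp

/-- Cutting off an approximation. -/
theorem eLpNorm_smul_sub_le {N : ℕ} {F : Type*} [NormedAddCommGroup F] [NormedSpace ℝ F]
    {f h : Eu N → F} (hf : AEStronglyMeasurable f volume) (hh : AEStronglyMeasurable h volume)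
    {χ : Eu N → ℝ} (hχ : Continuous χ) (h01 : ∀ x, 0 ≤ χ x ∧ χ x ≤ 1) {r : ℝ}
    (h1 : ∀ x ∈ Metric.ball (0 : Eu N) r, χ x = 1) :
    eLpNorm (fun x => χ x • h x - f x) 2 volume
      ≤ eLpNorm (h - f) 2 volume + eLpNorm ((Metric.ball (0 : Eu N) r)ᶜ.indicator f) 2 volume := by
  -- The first summand is the cut-off approximation error. The second is supported where `χ ≠ 1`,
  -- hence outside the ball.
  have e : (fun x => χ x • h x - f x)
      = (fun x => χ x • (h x - f x)) + (fun x => (χ x - 1) • f x) := by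
    ext1 x
    simp only [Pi.add_apply]
    module
  rw [e]
  refine (eLpNorm_add_le (hχ.aestronglyMeasurable.smul (hh.sub hf))
    ((hχ.sub continuous_const).aestronglyMeasurable.smul hf) (by norm_num)).trans ?_
  gcongr
  · refine eLpNorm_mono fun x => ?_
    change ‖χ x • (h x - f x)‖ ≤ ‖h x - f x‖
    rw [norm_smul, Real.norm_of_nonneg (h01 x).1]
    exact mul_le_of_le_one_left (norm_nonneg _) (h01 x).2
  · refine eLpNorm_mono fun x => ?_
    change ‖(χ x - 1) • f x‖ ≤ _
    by_cases hx : x ∈ Metric.ball (0 : Eu N) r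
    · rw [h1 x hx]
      simp
    · rw [Set.indicator_of_mem (Set.mem_compl hx), norm_smul]
      refine mul_le_of_le_one_left (norm_nonneg _) ?_
      rw [Real.norm_eq_abs, abs_le]
      constructor <;> linarith [(h01 x).1, (h01 x).2]

/-- Density of `C_c^∞` in `H^1`. -/
theorem exists_isTestFunction_close {N : ℕ} {u : Eu N → ℝ} {g : Eu N → Eu N} (hu : MemLp u 2)
    (hg2 : MemLp g 2) (hg : HasWeakGradient Set.univ u g) {ε : ENNReal} (hε : 0 < ε) :
    ∃ φ : Eu N → ℝ, IsTestFunction Set.univ φ ∧ eLpNorm (fun x => φ x - u x) 2 volume ≤ ε ∧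
      eLpNorm (fun x => gradient φ x - g x) 2 volume ≤ ε := by
  -- Finiteness of `ε` is what shows that the mollified function is in `L²`, in `hwL`.
  wlog hε1 : ε ≤ 1 generalizing ε
  · obtain ⟨φ, h1, h2, h3⟩ := this (ε := min ε 1) (lt_min hε one_pos) (min_le_right _ _)
    exact ⟨φ, h1, h2.trans (min_le_left _ _), h3.trans (min_le_left _ _)⟩
  have hε4 : 0 < ε / 4 := ENNReal.div_pos hε.ne' (by simp)
  obtain ⟨δ₁, hδ₁, hd1⟩ := exists_eLpNorm_mollify_sub_le hu hε4
  obtain ⟨δ₂, hδ₂, hd2⟩ := exists_eLpNorm_mollify_sub_le hg2 hε4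
  obtain ⟨C, hC, χ, hχ⟩ := exists_cutoff_sequence N
  let B : ContDiffBump (0 : Eu N) := ⟨min δ₁ δ₂ / 2, min δ₁ δ₂, half_pos (lt_min hδ₁ hδ₂),
    half_lt_self (lt_min hδ₁ hδ₂)⟩
  set ψ := B.normed (volume : Measure (Eu N)) with hψ
  have hψs : ContDiff ℝ ∞ ψ := B.contDiff_normed
  have hψc : HasCompactSupport ψ := B.hasCompactSupport_normed
  have a1 := hd1 B (min_le_left _ _)
  have a2 := hd2 B (min_le_right _ _)
  rw [← hψ] at a1 a2
  have hul : LocallyIntegrable u := locallyIntegrableOn_univ.1 hg.locallyIntegrableOn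
  set w := mollify ψ u with hw
  have hws : ContDiff ℝ ∞ w := contDiff_mollify hul hψs hψc
  have hwg : gradient w = mollify ψ g := funext fun x => hg.gradient_mollify hψs hψc x
  have hw1 : ContDiff ℝ 1 w := hws.of_le (by exact_mod_cast le_top)
  have hgm : AEStronglyMeasurable (mollify ψ g) volume := by
    rw [← hwg]
    exact (continuous_gradient hw1).aestronglyMeasurable
  have hwL : eLpNorm w 2 volume ≠ ⊤ := by
    have : w = (w - u) + u := by simp
    rw [this]
    refine ne_top_of_le_ne_top ?_ (eLpNorm_add_le (hws.continuous.aestronglyMeasurable.sub hu.1)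
      hu.1 (by norm_num))
    exact ENNReal.add_ne_top.2 ⟨ne_top_of_le_ne_top
      (ENNReal.div_ne_top (ne_top_of_le_ne_top (by simp) hε1) (by simp)) a1, hu.2.ne⟩
  have hlim : Tendsto (fun n : ℕ => ENNReal.ofReal (C * (n : ℝ)⁻¹) * eLpNorm w 2 volume)
      atTop (𝓝 0) := by
    have h0 : Tendsto (fun n : ℕ => C * (n : ℝ)⁻¹) atTop (𝓝 0) := by
      simpa using (tendsto_inv_atTop_nhds_zero_nat (𝕜 := ℝ)).const_mul C
    have h1 := ENNReal.Tendsto.mul_const (b := eLpNorm w 2 volume) (ENNReal.tendsto_ofReal h0)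
      (Or.inr hwL)
    simpa using h1
  obtain ⟨n, hn0, hn1, hn2, hn3⟩ := ((eventually_gt_atTop 0).and
    ((ENNReal.tendsto_nhds_zero.1 (tendsto_eLpNorm_indicator_compl_ball hu) _ hε4).and
    ((ENNReal.tendsto_nhds_zero.1 (tendsto_eLpNorm_indicator_compl_ball hg2) _ hε4).and
    (ENNReal.tendsto_nhds_zero.1 hlim _ hε4)))).exists
  obtain ⟨ht, h01, hone, hgrad⟩ := hχ n hn0
  -- The gradient has three errors: mollifying `g`, the tail of `g`, and the term `w ∇χ_n` of size
  -- `O(1/n)`.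
  have hquart : ε / 4 + ε / 4 + ε / 4 ≤ ε := by
    have e1 : ε / 4 + ε / 4 + ε / 4 + ε / 4 = ε := by
      rw [ENNReal.div_add_div_same, ENNReal.div_add_div_same, ENNReal.div_add_div_same]
      rw [show ε + ε + ε + ε = ε * 4 by ring]
      exact ENNReal.mul_div_cancel_right (by simp) (by simp)
    calc ε / 4 + ε / 4 + ε / 4 ≤ ε / 4 + ε / 4 + ε / 4 + ε / 4 := le_self_add
      _ = ε := e1
  have hgr : ∀ x, gradient (fun x => χ n x * w x) x
      = χ n x • mollify ψ g x + w x • gradient (χ n) x := fun x => by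
    rw [gradient_mul (ht.contDiff.differentiable (by simp)) (hws.differentiable (by simp)), hwg]
  refine ⟨fun x => χ n x * w x, ⟨ht.contDiff.mul hws, ht.hasCompactSupport.mul_right,
    Set.subset_univ _⟩, ?_, ?_⟩
  · have := eLpNorm_smul_sub_le hu.1 hws.continuous.aestronglyMeasurable ht.contDiff.continuous
      h01 hone
    simp only [smul_eq_mul] at this
    exact (this.trans (add_le_add a1 hn1)).trans (le_self_add.trans hquart)
  · have e : (fun x => gradient (fun x => χ n x * w x) x - g x)
        = (fun x => χ n x • mollify ψ g x - g x) + fun x => w x • gradient (χ n) x := by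
      ext1 x
      simp only [hgr, Pi.add_apply]
      abel
    have hχ1 : ContDiff ℝ 1 (χ n) := ht.contDiff.of_le (by exact_mod_cast le_top)
    rw [e]
    refine (eLpNorm_add_le
      ((ht.contDiff.continuous.aestronglyMeasurable.smul hgm).sub hg2.1)
      (hws.continuous.smul (continuous_gradient hχ1)).aestronglyMeasurable (by norm_num)).trans ?_
    refine le_trans (add_le_add ((eLpNorm_smul_sub_le hg2.1 hgm ht.contDiff.continuous
      h01 hone).trans (add_le_add a2 hn2)) (le_trans ?_ hn3)) hquart
    refine eLpNorm_le_mul_eLpNorm_of_ae_le_mul (ae_of_all _ fun x => ?_) 2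
    change ‖w x • gradient (χ n) x‖ ≤ _
    rw [norm_smul, mul_comm]
    gcongr
    exact hgrad x

/-! ### Existence and vanishing of the trace. -/

/-- Needed because the essential infimum with respect to the zero measure is `⊤`, even for the zero
function. -/
theorem sphereMeasure_ne_zero {N : ℕ} (hN : 0 < N) {M : ℝ} (hM : 0 < M) :
    sphereMeasure N M ≠ 0 := by
  have : Nontrivial (Eu N) := by
    have : Nonempty (Fin N) := ⟨⟨0, hN⟩⟩
    infer_instance
  have hm : Measurable (fun θ : Metric.sphere (0 : Eu N) 1 => M • (θ : Eu N)) :=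
    Measurable.const_smul (measurable_subtype_coe (p := (· ∈ Metric.sphere (0 : Eu N) 1))) M
  rw [← Measure.measure_univ_ne_zero, sphereMeasure, Measure.smul_apply, smul_eq_mul,
    Measure.map_apply hm MeasurableSet.univ, Set.preimage_univ]
  refine mul_ne_zero ?_ ?_
  · simpa using pow_pos hM _
  · rw [Measure.measure_univ_ne_zero]
    exact Measure.toSphere_ne_zero _

theorem isFiniteMeasure_sphereMeasure (N : ℕ) (M : ℝ) : IsFiniteMeasure (sphereMeasure N M) := by
  constructor
  rw [sphereMeasure, Measure.smul_apply, smul_eq_mul]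
  exact ENNReal.mul_lt_top ENNReal.ofReal_lt_top (measure_lt_top _ _)

theorem memLp_sphereMeasure {N : ℕ} {φ : Eu N → ℝ} (hφ : IsTestFunction Set.univ φ) (M : ℝ) :
    MemLp φ 2 (sphereMeasure N M) := by
  have := isFiniteMeasure_sphereMeasure N M
  obtain ⟨C, hC⟩ := hφ.hasCompactSupport.exists_bound_of_continuous hφ.contDiff.continuous
  exact MemLp.of_bound hφ.contDiff.continuous.aestronglyMeasurable C (ae_of_all _ hC)

theorem gradient_sub {N : ℕ} {a b : Eu N → ℝ} (ha : Differentiable ℝ a) (hb : Differentiable ℝ b)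
    (x : Eu N) : gradient (a - b) x = gradient a x - gradient b x := by
  refine HasGradientAt.gradient ?_
  rw [hasGradientAt_iff_hasFDerivAt]
  have h := (ha x).hasFDerivAt.sub (hb x).hasFDerivAt
  convert! h using 1
  ext v
  simp

/-- Existence of the trace. -/
theorem MemH1.exists_isSphereTrace {N : ℕ} (hN : 0 < N) {M : ℝ} (hM : 0 ≤ M) {u : Eu N → ℝ}
    (hu : MemH1 u) : ∃ T, IsSphereTrace u M T := by
  obtain ⟨hu2, g, hg2, hg⟩ := hu
  -- Two approximants beyond index `k` differ by at most `2 ε k` in each norm, and the trace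
  -- inequality then gives at most `4 ε k = (1/2)^k / 2` on the sphere. This is strictly below the
  -- summable bound `(1/2)^k` required by the completeness lemma.
  set ε : ℕ → ENNReal := fun n => (1 / 2) ^ n * (1 / 8) with hε
  have hε0 : ∀ n, 0 < ε n := fun n =>
    ENNReal.mul_pos (pow_ne_zero _ (by simp)) (by simp)
  choose φ hφ h1 h2 using fun n => exists_isTestFunction_close hu2 hg2 hg (hε0 n)
  have hanti : ∀ {m n : ℕ}, m ≤ n → ε n ≤ ε m := fun h => by
    have : ((1 : ENNReal) / 2) ≤ 1 := by simp
    exact mul_le_mul_left (pow_le_pow_right_of_le_one' this h) _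
  have hgeom : ∑' n, ((1 : ENNReal) / 2) ^ n ≠ ⊤ := by
    rw [ENNReal.tsum_geometric]
    simp
  have hε_tendsto : Tendsto ε atTop (𝓝 0) := by
    have := ENNReal.Tendsto.mul_const (b := (1 / 8 : ENNReal))
      (ENNReal.tendsto_pow_atTop_nhds_zero_of_lt_one
      (show (1 : ENNReal) / 2 < 1 by simp)) (Or.inr (by simp))
    simpa [hε] using this
  have hC1 : ∀ n, ContDiff ℝ 1 (φ n) := fun n => (hφ n).contDiff.of_le (by exact_mod_cast le_top)
  have tri : ∀ {F : Type} [NormedAddCommGroup F] (a b c : Eu N → F),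
      AEStronglyMeasurable a volume → AEStronglyMeasurable b volume →
      AEStronglyMeasurable c volume → ∀ e : ENNReal,
      eLpNorm (fun x => a x - c x) 2 volume ≤ e → eLpNorm (fun x => b x - c x) 2 volume ≤ e →
      eLpNorm (a - b) 2 volume ≤ 2 * e := by
    intro F _ a b c ha hb hc e hac hbc
    have e1 : a - b = (fun x => a x - c x) - fun x => b x - c x := by
      ext1 x; simp
    rw [e1, two_mul]
    exact (eLpNorm_sub_le (ha.sub hc) (hb.sub hc) (by norm_num)).trans (add_le_add hac hbc)
  have hcau : ∀ k n m : ℕ, k ≤ n → k ≤ m →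
      eLpNorm (φ n - φ m) 2 (sphereMeasure N M) < ((1 : ENNReal) / 2) ^ k := by
    intro k n m hn hm
    have b1 := tri (φ n) (φ m) u (hφ n).contDiff.continuous.aestronglyMeasurable
      (hφ m).contDiff.continuous.aestronglyMeasurable hu2.1 (ε k)
      ((h1 n).trans (hanti hn)) ((h1 m).trans (hanti hm))
    have b2 := tri (gradient (φ n)) (gradient (φ m)) g
      (continuous_gradient (hC1 n)).aestronglyMeasurable
      (continuous_gradient (hC1 m)).aestronglyMeasurable hg2.1 (ε k)
      ((h2 n).trans (hanti hn)) ((h2 m).trans (hanti hm))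
    have hgs : gradient (φ n - φ m) = gradient (φ n) - gradient (φ m) := funext fun x =>
      gradient_sub ((hφ n).contDiff.differentiable (by simp))
        ((hφ m).contDiff.differentiable (by simp)) x
    have htr := eLpNorm_sphereMeasure_sq_le hN hM ((hC1 n).sub (hC1 m))
      ((hφ n).hasCompactSupport.sub (hφ m).hasCompactSupport)
    change eLpNorm (φ n - φ m) 2 _ ^ 2 ≤ 2 * (eLpNorm (φ n - φ m) 2 _ *
      eLpNorm (gradient (φ n - φ m)) 2 _) at htr
    rw [hgs] at htr
    have h3 : eLpNorm (φ n - φ m) 2 (sphereMeasure N M) ^ 2 ≤ (4 * ε k) ^ 2 := by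
      calc _ ≤ 2 * (2 * ε k * (2 * ε k)) := by
            refine htr.trans ?_
            gcongr
            exact (eLpNorm_mono_measure _ Measure.restrict_le_self).trans b1
        _ = 8 * ε k ^ 2 := by ring
        _ ≤ 16 * ε k ^ 2 := by gcongr; norm_num
        _ = (4 * ε k) ^ 2 := by ring
    refine ((ENNReal.pow_le_pow_left_iff two_ne_zero).1 h3).trans_lt ?_
    have h4 : 4 * ε k = (1 / 2) ^ k * (1 / 2) := by
      have : (4 : ENNReal) * (1 / 8) = 1 / 2 := by
        rw [show (8 : ENNReal) = 4 * 2 by norm_num, one_div, one_div,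
          ENNReal.mul_inv (by simp) (by simp), ← mul_assoc,
          ENNReal.mul_inv_cancel (by simp) (by simp), one_mul]
      rw [hε, mul_left_comm, this]
    have hp0 : ((1 : ENNReal) / 2) ^ k ≠ 0 := pow_ne_zero _ (by simp)
    have hpt : ((1 : ENNReal) / 2) ^ k ≠ ⊤ := ENNReal.pow_ne_top (by simp)
    rw [h4, one_div, ← div_eq_mul_inv]
    rw [one_div] at hp0 hpt
    exact ENNReal.half_lt_self hp0 hpt
  obtain ⟨T, hT, hlim⟩ := Lp.cauchy_complete_eLpNorm (p := 2) (by norm_num)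
    (fun n => memLp_sphereMeasure (hφ n) M) hgeom hcau
  exact ⟨T, hT, g, hg, φ, hφ,
    tendsto_of_tendsto_of_tendsto_of_le_of_le tendsto_const_nhds hε_tendsto (fun _ => bot_le) h1,
    tendsto_of_tendsto_of_tendsto_of_le_of_le tendsto_const_nhds hε_tendsto (fun _ => bot_le) h2,
    hlim⟩

/-- The trace of a function that vanishes outside the sphere is zero. -/
theorem IsSphereTrace.ae_eq_zero {N : ℕ} (hN : 0 < N) {M : ℝ} (hM : 0 ≤ M) {u T : Eu N → ℝ}
    (hT : IsSphereTrace u M T) (h0 : ∀ᵐ x : Eu N, M < ‖x‖ → u x = 0) :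
    T =ᵐ[sphereMeasure N M] 0 := by
  obtain ⟨hT2, g, hg, φ, hφ, hφu, hφg, hφT⟩ := hT
  set S := {x : Eu N | M < ‖x‖} with hS
  have hSm : MeasurableSet S := measurableSet_lt measurable_const measurable_norm
  have hC1 : ∀ n, ContDiff ℝ 1 (φ n) := fun n => (hφ n).contDiff.of_le (by exact_mod_cast le_top)
  have hgm : AEStronglyMeasurable g volume :=
    (locallyIntegrableOn_univ.1 hg.locallyIntegrableOn_grad).aestronglyMeasurable
  -- The definition of the trace does not ask for `g ∈ L²`; it follows because `g` is at finite `L²`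
  -- distance from the gradient of a test function.
  have hgL : eLpNorm g 2 volume ≠ ⊤ := by
    obtain ⟨n, hn⟩ := (ENNReal.tendsto_nhds_zero.1 hφg 1 one_pos).exists
    have hgc := continuous_gradient (hC1 n)
    have e : g = gradient (φ n) - fun x => gradient (φ n) x - g x := by
      ext1 x; simp
    have hφL : MemLp (gradient (φ n)) 2 volume := by
      refine hgc.memLp_of_hasCompactSupport ((hφ n).hasCompactSupport.mono'
        (fun x hx => support_fderiv_subset ℝ fun h0 => hx ?_))
      simp [gradient, h0]
    rw [e]
    exact ne_top_of_le_ne_top (ENNReal.add_ne_top.2 ⟨hφL.2.ne, ne_top_of_le_ne_top (by simp) hn⟩)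
      (eLpNorm_sub_le hgc.aestronglyMeasurable (hgc.aestronglyMeasurable.sub hgm) (by norm_num))
  have hext : ∀ n, eLpNorm (φ n) 2 (volume.restrict S) ≤ eLpNorm (fun x => φ n x - u x) 2 volume := by
    intro n
    have : φ n =ᵐ[volume.restrict S] fun x => φ n x - u x := by
      rw [EventuallyEq, ae_restrict_iff' hSm]
      filter_upwards [h0] with x hx hxS
      rw [hx hxS, sub_zero]
    rw [eLpNorm_congr_ae this]
    exact eLpNorm_mono_measure _ Measure.restrict_le_self
  have hgrad : ∀ n, eLpNorm (gradient (φ n)) 2 volume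
      ≤ eLpNorm (fun x => gradient (φ n) x - g x) 2 volume + eLpNorm g 2 volume := by
    intro n
    have e : gradient (φ n) = (fun x => gradient (φ n) x - g x) + g := by
      ext1 x; simp
    conv_lhs => rw [e]
    exact eLpNorm_add_le ((continuous_gradient (hC1 n)).aestronglyMeasurable.sub hgm) hgm
      (by norm_num)
  -- Outside the sphere `φ_n` equals `φ_n - u` a.e., so its exterior norm tends to zero while the
  -- gradient norms stay bounded. The product in the trace inequality therefore tends to zero.
  have hsq : Tendsto (fun n => eLpNorm (φ n) 2 (sphereMeasure N M) ^ 2) atTop (𝓝 0) := by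
    have hb : Tendsto (fun n => 2 * (eLpNorm (fun x => φ n x - u x) 2 volume *
        (eLpNorm (fun x => gradient (φ n) x - g x) 2 volume + eLpNorm g 2 volume)))
        atTop (𝓝 (2 * (0 * (0 + eLpNorm g 2 volume)))) := by
      refine ENNReal.Tendsto.const_mul ?_ (Or.inr (by simp))
      exact ENNReal.Tendsto.mul hφu (Or.inr (by simpa using hgL)) (hφg.add tendsto_const_nhds)
        (Or.inr (by simp))
    rw [zero_mul, mul_zero] at hb
    refine tendsto_of_tendsto_of_tendsto_of_le_of_le tendsto_const_nhds hb (fun _ => bot_le)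
      fun n => ?_
    refine (eLpNorm_sphereMeasure_sq_le hN hM (hC1 n) (hφ n).hasCompactSupport).trans ?_
    gcongr
    · exact hext n
    · exact hgrad n
  have hlim : Tendsto (fun n => eLpNorm (φ n) 2 (sphereMeasure N M)) atTop (𝓝 0) := by
    have := (ENNReal.continuous_rpow_const (y := (1 : ℝ) / 2)).tendsto 0 |>.comp hsq
    rw [ENNReal.zero_rpow_of_pos (by norm_num)] at this
    refine this.congr fun n => ?_
    rw [Function.comp_apply, ← ENNReal.rpow_natCast, ← ENNReal.rpow_mul]
    norm_num
  have hT0 : eLpNorm T 2 (sphereMeasure N M) ≤ 0 := by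
    have hsum : Tendsto (fun n => eLpNorm (φ n) 2 (sphereMeasure N M)
        + eLpNorm (fun x => φ n x - T x) 2 (sphereMeasure N M)) atTop (𝓝 (0 + 0)) :=
      hlim.add hφT
    rw [add_zero] at hsum
    refine ge_of_tendsto hsum (Eventually.of_forall fun n => ?_)
    have hm := (hφ n).contDiff.continuous.aestronglyMeasurable (μ := sphereMeasure N M)
    have e : T = φ n - fun x => φ n x - T x := by
      ext1 x; simp
    conv_lhs => rw [e]
    exact eLpNorm_sub_le hm (hm.sub hT2.1) (by norm_num)
  exact (eLpNorm_eq_zero_iff hT2.1 (by simp)).1 (le_antisymm hT0 bot_le)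

end ExteriorLiouville

/-! ### The theorem. -/

theorem lemmaA1 (N : ℕ) (hN : N = 3 ∨ N = 4) (ρ : ℝ) (hρ : 0 < ρ)
    (V u : EuclideanSpace ℝ (Fin N) → ℝ)
    (hV : ExteriorLiouville.MemLinftyLoc (Metric.ball 0 ρ)ᶜ V)
    (hVle : ∀ᵐ x : EuclideanSpace ℝ (Fin N), ρ ≤ ‖x‖ →
      V x ≤ (N : ℝ) * (4 - (N : ℝ)) / 4 * (‖x‖ ^ 2)⁻¹)
    (hu : ExteriorLiouville.MemH1 u)
    (hu0 : ∀ᵐ x : EuclideanSpace ℝ (Fin N), ρ ≤ ‖x‖ → 0 ≤ u x)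
    (hAu : ExteriorLiouville.IsWeakSupersolution (Metric.closedBall 0 ρ)ᶜ V u) :
    (∀ M : ℝ, ρ ≤ M →
      (∃ T, ExteriorLiouville.IsSphereTrace u M T) ∧
      ∀ T, ExteriorLiouville.IsSphereTrace u M T →
        essInf (fun x => (T x : EReal)) (ExteriorLiouville.sphereMeasure N M) = 0) ∧
    (ContDiffOn ℝ 1 u (Metric.closedBall 0 ρ)ᶜ →
      ∀ x : EuclideanSpace ℝ (Fin N), ρ < ‖x‖ → u x = 0) := by
  have hN0 : 0 < N := by omega
  have hz := ExteriorLiouville.ae_eq_zero_of_supersolution (by omega) hρ.le hV hVle hu.1 hu0 hAu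
  refine ⟨fun M hM => ⟨hu.exists_isSphereTrace hN0 (hρ.le.trans hM), fun T hT => ?_⟩,
    fun hC x hx => ?_⟩
  · have hT0 := hT.ae_eq_zero hN0 (hρ.le.trans hM) (by
      filter_upwards [hz] with x hx h using hx (hM.trans_lt h))
    have : (fun x => (T x : EReal)) =ᵐ[ExteriorLiouville.sphereMeasure N M] fun _ => 0 := by
      filter_upwards [hT0] with x hx
      simp [hx]
    rw [essInf_congr_ae this]
    exact essInf_const _ (ExteriorLiouville.sphereMeasure_ne_zero hN0 (hρ.trans_le hM))
  · have hopen : IsOpen (Metric.closedBall (0 : EuclideanSpace ℝ (Fin N)) ρ)ᶜ :=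
      Metric.isClosed_closedBall.isOpen_compl
    have hmem : ∀ y : EuclideanSpace ℝ (Fin N), y ∈ (Metric.closedBall 0 ρ)ᶜ ↔ ρ < ‖y‖ := by simp
    have hae : u =ᵐ[volume.restrict (Metric.closedBall 0 ρ)ᶜ] fun _ => 0 := by
      rw [EventuallyEq, ae_restrict_iff' hopen.measurableSet]
      filter_upwards [hz] with y hy h using hy ((hmem y).1 h)
    -- Only continuity of `u` is needed: nonempty open sets have positive measure, so a.e. equality
    -- on an open set upgrades to equality everywhere on it.
    exact Measure.eqOn_open_of_ae_eq hae hopen hC.continuousOn continuousOn_const ((hmem x).2 hx)
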